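/- **Setting.** Let $(\mathcal X,\mathcal B)$ be a measurable space and $X_1,\dots,X_n$ an i.i.d. sample from a probability measure $P_0$ on it, with empirical measure $\mathbb P_n$; write $Pf=\int f\,dP$ and $\mathbb G_n=n^{1/2}(\mathbb P_n-P_0)$. Let $T(\eta,P)\in\mathbb R$ be a function of a nuisance value $\eta\in\mathcal H$ and a distribution $P$, let $\eta_0\in\mathcal H$, and let the parameter of interest be $\psi_0=T(\eta_0,P_0)$. Let $\phi_0:\mathcal X\to\mathbb R$ be a function with $P_0\phi_0=0$ and $P_0\phi_0^2<\infty$, and put $\sigma_0^2=P_0\phi_0^2$, $\sigma_0\ge 0$. Let $\eta_n\in\mathcal H$ and $\phi_n:\mathcal X\to\mathbb R$ be arbitrary (possibly non-measurable) functions of $X_1,\dots,X_n$. Let $W_{n1},\dots,W_{nn}$ be i.i.d. with law $Q_n$ on a measurable space, independent of the data, and let $X_i^*=\gamma_n(X_1,\dots,X_n,W_{ni})$ with $\gamma_n$ a fixed measurable function. Let $\hat P_n$ be the conditional law of $X_i^*$ given the data, $\mathbb P_n^*$ the empirical measure of $X_1^*,\dots,X_n^*$ and $\mathbb G_n^*=n^{1/2}(\mathbb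 P_n^*-\hat P_n)$. Let $\eta_n^*\in\mathcal H$ and $\phi_n^*:\mathcal X\to\mathbb R$ be arbitrary functions of the data and of the bootstrap sample. Put $$R_n=T(\eta_n,\mathbb P_n)-T(\eta_0,P_0)-(\mathbb P_n-P_0)\phi_n,\qquad R_n^*=T(\eta_n^*,\mathbb P_n^*)-T(\eta_n,\hat P_n)-(\mathbb P_n^*-\hat P_n)\phi_n^*,$$ $$T_n^*=n^{1/2}\,[T(\eta_n^*,\mathbb P_n^*)-T(\eta_n,\hat P_n)].$$ $E_0^*,P_0^*$ denote outer expectation and outer probability for the law of the data, and $E_W^*,P_W^*$ those for the law of $(W_{n1},\dots,W_{nn})$ with the data held fixed. $Y_n\xrightarrow{P_0^*}c$ means $P_0^*(|Y_n-c|\ge\varepsilon)\to0$ for every $\varepsilon>0$; $Y_n=o_{P_0^*}(r_n)$ means $Y_n/r_n\xrightarrow{P_0^*}0$; $Y_n=o_{P_W^*}(r_n)$ means $P_W^*(|Y_n|/r_n\ge\varepsilon)\xrightarrow{P_0^*}0$ for every $\varepsilon>0$. For a class $\mathcal F$ of functions, $\ell^\infty(\mathcal F)$ is the space of bounded real functions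 on $\mathcal F$ with the supremum norm, and a $P_0$-Brownian bridge $\mathbb G_0$ on $\mathcal F\subset L_2(P_0)$ is a tight, Borel measurable random element of $\ell^\infty(\mathcal F)$ that is a mean-zero Gaussian process with covariance $P_0(fg)-P_0f\,P_0g$. **Conditions.** * (A1) There is a class $\mathcal F$ of measurable functions $\mathcal X\to\mathbb R$ with $\phi_0\in\mathcal F$ and $P_0^*(\phi_n\notin\mathcal F)\to0$ such that $\mathbb G_n\rightsquigarrow\mathbb G_0$ in $\ell^\infty(\mathcal F)$ for a $P_0$-Brownian bridge $\mathbb G_0$, i.e. $E_0^*h(\mathbb G_n)\to E\,h(\mathbb G_0)$ for every bounded continuous $h:\ell^\infty(\mathcal F)\to\mathbb R$. * (A2) $\|\phi_n-\phi_0\|_{L_2(P_0)}=o_{P_0^*}(1)$. * (A3) $R_n=o_{P_0^*}(n^{-1/2})$. * (B1) There is a class $\mathcal F$ of measurable functions $\mathcal X\to\mathbb R$ (possibly a different one) with $\phi_0\in\mathcal F$ and $P_W^*(\phi_n^*\notin\mathcal F)\xrightarrow{P_0^*}0$ such that, for a $P_0$-Brownian bridge $\mathbb G_0$ in $\ell^\infty(\mathcal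 F)$, $\sup_h|E_W^*h(\mathbb G_n^*)-E\,h(\mathbb G_0)|\xrightarrow{P_0^*}0$, the supremum being over all $1$-Lipschitz $h:\ell^\infty(\mathcal F)\to[-1,1]$. * (B2) $\|\phi_n^*-\phi_0\|_{L_2(P_0)}=o_{P_W^*}(1)$. * (B3) $R_n^*=o_{P_W^*}(n^{-1/2})$. It is part of (A1) and (B1) that, for all large $n$, the processes $\mathbb G_n$ and $\mathbb G_n^*$ are well defined on $\mathcal F$ and almost surely bounded there. **Theorem.** Suppose that (A1)–(A3) and (B1)–(B3) hold and that $T_n^*$ is asymptotically uniformly square-integrable: $$\lim_{m\to\infty}\limsup_{n\to\infty}E_0^*E_W^*\big[T_n^{*2}\,1\{T_n^{*2}\ge m\}\big]=0 .$$ Then the bootstrap variance $\bar\sigma_n^2=E_W^*[T_n^{*2}]$ satisfies $\bar\sigma_n^2\xrightarrow{P_0^*}\sigma_0^2$ and $\bar\sigma_n\xrightarrow{P_0^*}\sigma_0$. If moreover $\sigma_0^2>0$, then for all $\alpha,\beta>0$ with $\alpha+\beta<1$ the bootstrap Wald interval $$\big[\,T(\eta_n,\mathbb P_n)+z_\beta\,\bar\sigma_n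 n^{-1/2},\ T(\eta_n,\mathbb P_n)+z_{1-\alpha}\,\bar\sigma_n n^{-1/2}\,\big],$$ where $z_p$ is the lower $p$-quantile of the standard normal distribution, has asymptotic confidence level $1-\alpha-\beta$: the probability (both outer and inner) that it contains $\psi_0$ tends to $1-\alpha-\beta$. -/

import Mathlib

open MeasureTheory ProbabilityTheory Filter Topology
open scoped ENNReal BoundedContinuousFunction

noncomputable section

/-! ### Outer expectations

The outer probability `P^*(A) = E^* 1_A` of an arbitrary set `A` is the infimum of `P(B)` over the
measurable `B ⊇ A`. This is how a Mathlib measure is evaluated on non-measurable sets, so outer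
probabilities are written `μ A` below. -/

/-- Outer expectation of an arbitrary `[0, ∞]`-valued function: infimum of the integrals of its
almost sure measurable majorants. -/
def outerLIntegral {Ω : Type*} [MeasurableSpace Ω] (μ : Measure Ω) (h : Ω → ℝ≥0∞) : ℝ≥0∞ :=
  sInf {r | ∃ U : Ω → ℝ≥0∞, Measurable U ∧ (∀ᵐ ω ∂μ, h ω ≤ U ω) ∧ r = ∫⁻ ω, U ω ∂μ}

/-- Outer expectation of an arbitrary bounded real function under a probability measure: infimum
of the integrals of its almost sure measurable majorants. (For bounded `h` the constant majorant is
integrable, so that majorants with infinite integral do not matter for the infimum.) It is only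
applied to bounded functions. -/
def outerExp {Ω : Type*} [MeasurableSpace Ω] (μ : Measure Ω) (h : Ω → ℝ) : ℝ :=
  sInf {r | ∃ U : Ω → ℝ, Measurable U ∧ Integrable U μ ∧ (∀ᵐ ω ∂μ, h ω ≤ U ω) ∧
    r = ∫ ω, U ω ∂μ}

/-! ### Modes of convergence

The `n`-th random element lives on its own probability space `(Ω n, μ n)`; the additional
(bootstrap) randomness lives on `(Ω' n, κ n)`. -/

/-- `Y n = o_{P^*}(1)`, for sequences of deviations `Y n ≥ 0` (possibly infinite). -/
def ConvOuterProb {Ω : ℕ → Type*} [∀ n, MeasurableSpace (Ω n)] (μ : ∀ n, Measure (Ω n))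
    (Y : ∀ n, Ω n → ℝ≥0∞) : Prop :=
  ∀ ε : ℝ, 0 < ε → Tendsto (fun n => μ n {ω | ENNReal.ofReal ε ≤ Y n ω}) atTop (𝓝 0)

/-- `Y n = o_{P_W^*}(1)`, for sequences of deviations `Y n ≥ 0`: for every `ε > 0` the conditional
outer probability of `Y n ≥ ε` converges to zero in outer probability. -/
def CondConvOuterProb {Ω Ω' : ℕ → Type*} [∀ n, MeasurableSpace (Ω n)]
    [∀ n, MeasurableSpace (Ω' n)] (μ : ∀ n, Measure (Ω n)) (κ : ∀ n, Measure (Ω' n))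
    (Y : ∀ n, Ω n → Ω' n → ℝ≥0∞) : Prop :=
  ∀ ε : ℝ, 0 < ε → ConvOuterProb μ (fun n x => κ n {w | ENNReal.ofReal ε ≤ Y n x w})

/-- Weak convergence of arbitrary maps `G n` into a metric space to a Borel law `ν`. -/
def OuterWeakConv {Ω : ℕ → Type*} [∀ n, MeasurableSpace (Ω n)] (μ : ∀ n, Measure (Ω n))
    {D : Type*} [PseudoMetricSpace D] [MeasurableSpace D] (G : ∀ n, Ω n → D)
    (ν : Measure D) : Prop :=
  ∀ h : D →ᵇ ℝ, Tendsto (fun n => outerExp (μ n) (fun ω => h (G n ω))) atTop (𝓝 (∫ z, h z ∂ν))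

/-- The functions `h : D → [-1, 1]` that are `1`-Lipschitz. -/
def BL1 (D : Type*) [PseudoMetricSpace D] : Set (D → ℝ) :=
  {h | LipschitzWith 1 h ∧ ∀ z, |h z| ≤ 1}

/-- Conditional weak convergence, in outer probability, of arbitrary maps `G n` into a metric space
to a Borel law `ν`: `sup_{h ∈ BL₁} |E_W^* h(G n) - E h(G)| → 0` in outer probability. -/
def CondOuterWeakConv {Ω Ω' : ℕ → Type*} [∀ n, MeasurableSpace (Ω n)]
    [∀ n, MeasurableSpace (Ω' n)] (μ : ∀ n, Measure (Ω n)) (κ : ∀ n, Measure (Ω' n))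
    {D : Type*} [PseudoMetricSpace D] [MeasurableSpace D] (G : ∀ n, Ω n → Ω' n → D)
    (ν : Measure D) : Prop :=
  ConvOuterProb μ (fun n x => ⨆ h ∈ BL1 D,
    ENNReal.ofReal |outerExp (κ n) (fun w => h (G n x w)) - ∫ z, h z ∂ν|)

/-! ### The space `ℓ^∞(F)` and the Brownian bridge -/

/-- Bounded real functions on the class `F`, with the supremum norm. -/
abbrev EllInf {𝒳 : Type*} (F : Set (𝒳 → ℝ)) : Type _ := lp (fun _ : F => ℝ) ∞

/-- `ℓ^∞(F)` carries its Borel `σ`-algebra. -/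
instance EllInf.measurableSpace {𝒳 : Type*} (F : Set (𝒳 → ℝ)) : MeasurableSpace (EllInf F) :=
  borel _

instance EllInf.borelSpace {𝒳 : Type*} (F : Set (𝒳 → ℝ)) : BorelSpace (EllInf F) := ⟨rfl⟩

open Classical in
/-- A bounded function on `F` as an element of `ℓ^∞(F)` (unbounded functions, which occur with
probability zero wherever this is used, are sent to `0`). -/
def toEllInf {𝒳 : Type*} (F : Set (𝒳 → ℝ)) (z : F → ℝ) : EllInf F :=
  if h : Memℓp (E := fun _ : F => ℝ) z ∞ then ⟨z, h⟩ else 0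

/-- `ν` is the law on `ℓ^∞(F)` of a tight, Borel measurable `P`-Brownian bridge: a Gaussian process
with mean zero and covariance `P(fg) - Pf Pg`, indexed by `F ⊆ L₂(P)`. -/
structure IsBrownianBridge {𝒳 : Type*} [MeasurableSpace 𝒳] (P : Measure 𝒳) (F : Set (𝒳 → ℝ))
    (ν : Measure (EllInf F)) : Prop where
  isProbabilityMeasure : IsProbabilityMeasure ν
  tight : IsTightMeasureSet {ν}
  memLp : ∀ f ∈ F, MemLp f 2 P
  gaussian : IsGaussianProcess (fun (f : F) (z : EllInf F) => z f) ν
  mean : ∀ f : F, ∫ z : EllInf F, z f ∂ν = 0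
  cov : ∀ f g : F, ∫ z : EllInf F, z f * z g ∂ν =
    ∫ x, f.1 x * g.1 x ∂P - (∫ x, f.1 x ∂P) * ∫ x, g.1 x ∂P

/-! ### Empirical measures -/

/-- The empirical measure of a sample. -/
def empMeasure {𝒳 : Type*} [MeasurableSpace 𝒳] {n : ℕ} (x : Fin n → 𝒳) : Measure 𝒳 :=
  (n : ℝ≥0∞)⁻¹ • ∑ i, Measure.dirac (x i)

/-- The integral of `f` against the empirical measure of a sample, i.e. the sample mean of `f`. -/
def empMean {𝒳 : Type*} {n : ℕ} (x : Fin n → 𝒳) (f : 𝒳 → ℝ) : ℝ :=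
  (∑ i, f (x i)) / n

/-! ### The estimation and bootstrap framework -/

/-- The data of the problem. The estimators are arbitrary (possibly non-measurable) functions of
the data. -/
structure BootstrapFramework (𝒳 H : Type*) [MeasurableSpace 𝒳] where
  /-- The distribution of the observations. -/
  P₀ : ProbabilityMeasure 𝒳
  /-- The map that takes a nuisance value and a distribution to a value of the parameter. Only its
  values at `P₀`, at empirical measures and at bootstrap sampling distributions are used, so a map
  defined on a smaller set of distributions may be extended arbitrarily. -/
  T : H → Measure 𝒳 → ℝ
  /-- The true nuisance parameter. -/
  η₀ : H
  /-- The influence function. -/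
  φ₀ : 𝒳 → ℝ
  φ₀_memLp : MemLp φ₀ 2 (P₀ : Measure 𝒳)
  φ₀_mean : ∫ x, φ₀ x ∂(P₀ : Measure 𝒳) = 0
  /-- The nuisance estimator, a function of the data `X₁, …, Xₙ`. -/
  η : ∀ n, (Fin n → 𝒳) → H
  /-- The estimator of the influence function. -/
  φ : ∀ n, (Fin n → 𝒳) → 𝒳 → ℝ
  /-- The spaces of the variables `W_{ni}` that generate the bootstrap sample. -/
  W : ℕ → Type*
  [measW : ∀ n, MeasurableSpace (W n)]
  /-- The distribution of each `W_{ni}`. -/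
  Q : ∀ n, ProbabilityMeasure (W n)
  /-- The bootstrap sample is `X_i^* = γₙ(X₁, …, Xₙ, W_{ni})`. -/
  γ : ∀ n, (Fin n → 𝒳) → W n → 𝒳
  measurable_γ : ∀ n, Measurable (Function.uncurry (γ n))
  /-- The bootstrap nuisance estimator, a function of the data and of the bootstrap sample. -/
  ηs : ∀ n, (Fin n → 𝒳) → (Fin n → 𝒳) → H
  /-- The bootstrap estimator of the influence function. -/
  φs : ∀ n, (Fin n → 𝒳) → (Fin n → 𝒳) → 𝒳 → ℝ

namespace BootstrapFramework

attribute [instance] BootstrapFramework.measW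

variable {𝒳 H : Type*} [MeasurableSpace 𝒳] (B : BootstrapFramework 𝒳 H)

/-- The distribution `P₀ⁿ` of the data. -/
def dataLaw (n : ℕ) : Measure (Fin n → 𝒳) := Measure.pi (fun _ => (B.P₀ : Measure 𝒳))

/-- The distribution `Qₙⁿ` of `(W_{n1}, …, W_{nn})`; the conditional outer expectation and
probability given the data are those under `Qₙⁿ` with the data held fixed. -/
def bootLaw (n : ℕ) : Measure (Fin n → B.W n) := Measure.pi (fun _ => (B.Q n : Measure (B.W n)))

/-- The true value of the parameter. -/
def ψ₀ : ℝ := B.T B.η₀ B.P₀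

/-- The estimator `ψₙ = T(ηₙ, ℙₙ)`. -/
def ψ (n : ℕ) (x : Fin n → 𝒳) : ℝ := B.T (B.η n x) (empMeasure x)

/-- The bootstrap sampling distribution `P̂ₙ`: the conditional law of `X_i^*` given the data. -/
def Phat (n : ℕ) (x : Fin n → 𝒳) : Measure 𝒳 := (B.Q n : Measure (B.W n)).map (B.γ n x)

/-- The bootstrap sample. -/
def bootSample (n : ℕ) (x : Fin n → 𝒳) (w : Fin n → B.W n) : Fin n → 𝒳 := fun i => B.γ n x (w i)

/-- The bootstrap estimator `ψₙ^* = T(ηₙ^*, ℙₙ^*)`. -/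
def ψs (n : ℕ) (x : Fin n → 𝒳) (w : Fin n → B.W n) : ℝ :=
  B.T (B.ηs n x (B.bootSample n x w)) (empMeasure (B.bootSample n x w))

/-- `φₙ^*` as a function of the data and of `(W_{n1}, …, W_{nn})`. -/
def φboot (n : ℕ) (x : Fin n → 𝒳) (w : Fin n → B.W n) : 𝒳 → ℝ := B.φs n x (B.bootSample n x w)

/-- The empirical process `𝔾ₙ f = n^{1/2} (ℙₙ - P₀) f`. -/
def empProc (n : ℕ) (x : Fin n → 𝒳) (f : 𝒳 → ℝ) : ℝ :=
  √(n : ℝ) * (empMean x f - ∫ y, f y ∂(B.P₀ : Measure 𝒳))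

/-- The bootstrap empirical process `𝔾ₙ^* f = n^{1/2} (ℙₙ^* - P̂ₙ) f`. -/
def bootProc (n : ℕ) (x : Fin n → 𝒳) (w : Fin n → B.W n) (f : 𝒳 → ℝ) : ℝ :=
  √(n : ℝ) * (empMean (B.bootSample n x w) f - ∫ y, f y ∂(B.Phat n x))

/-- The remainder `Rₙ = T(ηₙ, ℙₙ) - T(η₀, P₀) - (ℙₙ - P₀) φₙ`. -/
def R (n : ℕ) (x : Fin n → 𝒳) : ℝ :=
  B.ψ n x - B.ψ₀ - (empMean x (B.φ n x) - ∫ y, B.φ n x y ∂(B.P₀ : Measure 𝒳))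

/-- The remainder `Rₙ^* = T(ηₙ^*, ℙₙ^*) - T(ηₙ, P̂ₙ) - (ℙₙ^* - P̂ₙ) φₙ^*`. -/
def Rs (n : ℕ) (x : Fin n → 𝒳) (w : Fin n → B.W n) : ℝ :=
  B.ψs n x w - B.T (B.η n x) (B.Phat n x) -
    (empMean (B.bootSample n x w) (B.φboot n x w) - ∫ y, B.φboot n x w y ∂(B.Phat n x))

/-- (A1): for a class `F ∋ φ₀` of measurable functions, `φₙ ∈ F` with probability tending to one
(the outer probability of `φₙ ∉ F` tends to zero) and `𝔾ₙ ⇝ 𝔾₀` in `ℓ^∞(F)`, with `𝔾₀` a `P₀`-Brownian bridge. -/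
def CondA1 : Prop :=
  ∃ F : Set (𝒳 → ℝ), (∀ f ∈ F, Measurable f) ∧ B.φ₀ ∈ F ∧
    Tendsto (fun n => B.dataLaw n {x | B.φ n x ∉ F}) atTop (𝓝 0) ∧
    (∀ᶠ n in atTop, ∀ᵐ x ∂(B.dataLaw n),
      Memℓp (E := fun _ : F => ℝ) (fun f : F => B.empProc n x f) ∞) ∧
    ∃ ν : Measure (EllInf F), IsBrownianBridge (B.P₀ : Measure 𝒳) F ν ∧
      OuterWeakConv B.dataLaw (fun n x => toEllInf F (fun f : F => B.empProc n x f)) ν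

/-- (A2): `‖φₙ - φ₀‖_{L₂(P₀)} = o_{P₀^*}(1)`. -/
def CondA2 : Prop :=
  ConvOuterProb B.dataLaw (fun n x => eLpNorm (B.φ n x - B.φ₀) 2 (B.P₀ : Measure 𝒳))

/-- (A3): `Rₙ = o_{P₀^*}(n^{-1/2})`. -/
def CondA3 : Prop :=
  ConvOuterProb B.dataLaw (fun n x => ENNReal.ofReal |√(n : ℝ) * B.R n x|)

/-- (B1): for a class `F ∋ φ₀` of measurable functions, the conditional probability of `φₙ^* ∈ F`
tends to one in outer probability (the conditional outer probability of `φₙ^* ∉ F` tends to zero in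
outer probability) and `𝔾ₙ^*` converges weakly to a `P₀`-Brownian bridge in
`ℓ^∞(F)`, conditionally on the data, in outer probability. -/
def CondB1 : Prop :=
  ∃ F : Set (𝒳 → ℝ), (∀ f ∈ F, Measurable f) ∧ B.φ₀ ∈ F ∧
    ConvOuterProb B.dataLaw (fun n x => B.bootLaw n {w | B.φboot n x w ∉ F}) ∧
    (∀ᶠ n in atTop, ∀ᵐ x ∂(B.dataLaw n), (∀ f ∈ F, Integrable f (B.Phat n x)) ∧
      ∀ᵐ w ∂(B.bootLaw n),
        Memℓp (E := fun _ : F => ℝ) (fun f : F => B.bootProc n x w f) ∞) ∧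
    ∃ ν : Measure (EllInf F), IsBrownianBridge (B.P₀ : Measure 𝒳) F ν ∧
      CondOuterWeakConv B.dataLaw B.bootLaw
        (fun n x w => toEllInf F (fun f : F => B.bootProc n x w f)) ν

/-- (B2): `‖φₙ^* - φ₀‖_{L₂(P₀)} = o_{P_W^*}(1)`. -/
def CondB2 : Prop :=
  CondConvOuterProb B.dataLaw B.bootLaw
    (fun n x w => eLpNorm (B.φboot n x w - B.φ₀) 2 (B.P₀ : Measure 𝒳))

/-- (B3): `Rₙ^* = o_{P_W^*}(n^{-1/2})`. -/
def CondB3 : Prop :=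
  CondConvOuterProb B.dataLaw B.bootLaw
    (fun n x w => ENNReal.ofReal |√(n : ℝ) * B.Rs n x w|)

/-- `Tₙ^* = n^{1/2} [T(ηₙ^*, ℙₙ^*) - T(ηₙ, P̂ₙ)]`. -/
def Tstar (n : ℕ) (x : Fin n → 𝒳) (w : Fin n → B.W n) : ℝ :=
  √(n : ℝ) * (B.ψs n x w - B.T (B.η n x) (B.Phat n x))

/-- Asymptotic uniform square-integrability of `Tₙ^*`:
`lim_{m → ∞} limsup_{n → ∞} E₀^* E_W^* [Tₙ^{*2} 1{Tₙ^{*2} ≥ m}] = 0`. -/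
def AsympUnifSqIntegrable : Prop :=
  Tendsto (fun m : ℕ => limsup (fun n : ℕ =>
    outerLIntegral (B.dataLaw n) (fun x => outerLIntegral (B.bootLaw n)
      ({w | (m : ℝ) ≤ B.Tstar n x w ^ 2}.indicator
        (fun w => ENNReal.ofReal (B.Tstar n x w ^ 2))))) atTop) atTop (𝓝 0)

/-- The asymptotic variance `σ₀² = P₀ φ₀²`. -/
def σ₀sq : ℝ := ∫ y, B.φ₀ y ^ 2 ∂(B.P₀ : Measure 𝒳)

/-- The bootstrap variance `σ̄ₙ² = E_W^* [Tₙ^{*2}]`. It may be infinite for some data. -/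
def σbarsq (n : ℕ) (x : Fin n → 𝒳) : ℝ≥0∞ :=
  outerLIntegral (B.bootLaw n) (fun w => ENNReal.ofReal (B.Tstar n x w ^ 2))

/-- The bootstrap standard deviation `σ̄ₙ`. -/
def σbar (n : ℕ) (x : Fin n → 𝒳) : ℝ≥0∞ := B.σbarsq n x ^ (1 / 2 : ℝ)

end BootstrapFramework

/-- The distance `|a - b|` of two elements of `[0, ∞]`, through truncated subtraction. -/
def absDiff (a b : ℝ≥0∞) : ℝ≥0∞ := (a - b) + (b - a)

/-- The lower `p`-quantile of the standard normal distribution. -/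
def normalQuantile (p : ℝ) : ℝ := sInf {z : ℝ | p ≤ cdf (gaussianReal 0 1) z}

/-- The bootstrap Wald interval
`[ψₙ + z_β σ̄ₙ n^{-1/2}, ψₙ + z_{1-α} σ̄ₙ n^{-1/2}]`, with endpoints in `[-∞, ∞]`. -/
def BootstrapFramework.waldInterval {𝒳 H : Type*} [MeasurableSpace 𝒳]
    (B : BootstrapFramework 𝒳 H) (α β : ℝ) (n : ℕ) (x : Fin n → 𝒳) : Set ℝ :=
  {t : ℝ |
    (B.ψ n x : EReal) + (normalQuantile β : EReal) * (B.σbar n x : EReal) /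
      ((√(n : ℝ) : ℝ) : EReal) ≤ (t : EReal) ∧
    (t : EReal) ≤ (B.ψ n x : EReal) + (normalQuantile (1 - α) : EReal) * (B.σbar n x : EReal) /
      ((√(n : ℝ) : ℝ) : EReal)}

end

/-! ### Outer integrals -/

section OuterIntegral

variable {Ω : Type*} [MeasurableSpace Ω] {μ : Measure Ω}

/-! The main difficulty is that the influence function estimators are random and arbitrary, so weak
convergence in `EllInf F` must yield that the empirical process changes little between `φₙ` and
`φ₀`. The device is `localOsc`, the truncated oscillation of a path over an `L₂(P₀)`-ball around
`φ₀`. It is bounded and 1-Lipschitz for the supremum norm, hence a test function for both modes of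
weak convergence. Its bridge expectation is small for small radius by tightness
(`exists_integral_localOsc_le`), weak convergence transfers this to the processes, and Markov's
inequality for outer expectations bounds the increments, with no measurability of the estimators.
Together with the remainder conditions, `√n (ψₙ - ψ₀)` and `Tstar` are then asymptotically
equivalent to the two processes evaluated at `φ₀`.

For the variance, truncate at `K ^ 2`. The truncated square of evaluation at `φ₀` is, up to scaling,
a bounded Lipschitz function (`min_sq_div_mem_BL1`), so its conditional bootstrap mean is close to
the bridge value. Linearization carries this over to `Tstar`, uniform square-integrability removes
the truncation for `Tstar`, and dominated convergence removes it for the bridge.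

For coverage, outside a set of vanishing outer probability the Wald event lies between two events
that place a Gaussian-limit variable in a slightly shrunk or enlarged interval. Continuity of the
normal distribution function closes the gap. -/

theorem outerLIntegral_mono_ae {h h' : Ω → ℝ≥0∞} (hh : ∀ᵐ ω ∂μ, h ω ≤ h' ω) :
    outerLIntegral μ h ≤ outerLIntegral μ h' := by
  refine le_sInf ?_
  rintro r ⟨U, hU, hle, rfl⟩
  exact sInf_le ⟨U, hU, by filter_upwards [hh, hle] with ω h1 h2 using h1.trans h2, rfl⟩

theorem outerLIntegral_mono {h h' : Ω → ℝ≥0∞} (hh : ∀ ω, h ω ≤ h' ω) :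
    outerLIntegral μ h ≤ outerLIntegral μ h' :=
  outerLIntegral_mono_ae (Eventually.of_forall hh)

theorem outerLIntegral_of_measurable {h : Ω → ℝ≥0∞} (hm : Measurable h) :
    outerLIntegral μ h = ∫⁻ ω, h ω ∂μ := by
  refine le_antisymm (sInf_le ⟨h, hm, Eventually.of_forall fun _ => le_rfl, rfl⟩) (le_sInf ?_)
  rintro r ⟨U, -, hle, rfl⟩
  exact lintegral_mono_ae hle

theorem outerLIntegral_add_le (h h' : Ω → ℝ≥0∞) :
    outerLIntegral μ (fun ω => h ω + h' ω) ≤ outerLIntegral μ h + outerLIntegral μ h' := by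
  unfold outerLIntegral
  rw [ENNReal.sInf_add]
  refine le_iInf₂ ?_
  rintro r ⟨U, hU, hle, rfl⟩
  rw [ENNReal.add_sInf]
  refine le_iInf₂ ?_
  rintro r ⟨V, hV, hle', rfl⟩
  refine sInf_le ⟨fun ω => U ω + V ω, hU.add hV, ?_, (lintegral_add_left hU V).symm⟩
  filter_upwards [hle, hle'] with ω h1 h2 using add_le_add h1 h2

theorem outerLIntegral_indicator_const_le (S : Set Ω) (c : ℝ≥0∞) :
    outerLIntegral μ (S.indicator fun _ => c) ≤ c * μ S := by
  refine sInf_le ⟨(toMeasurable μ S).indicator fun _ => c,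
    measurable_const.indicator (measurableSet_toMeasurable μ S), ?_, ?_⟩
  · exact Eventually.of_forall
      fun ω => Set.indicator_le_indicator_of_subset (subset_toMeasurable μ S) (by simp) ω
  · rw [lintegral_indicator_const (measurableSet_toMeasurable μ S), measure_toMeasurable]

/-- Markov's inequality for outer integrals. -/
theorem mul_measure_le_outerLIntegral (h : Ω → ℝ≥0∞) (c : ℝ≥0∞) :
    c * μ {ω | c ≤ h ω} ≤ outerLIntegral μ h := by
  refine le_sInf ?_
  rintro r ⟨U, hU, hle, rfl⟩
  refine le_trans ?_ (mul_meas_ge_le_lintegral hU c)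
  gcongr c * ?_
  refine measure_mono_ae ?_
  filter_upwards [hle] with ω h1 h2 using le_trans h2 h1

/-- Needed with a merely almost sure identity because `toEllInf` replaces unbounded paths by zero,
so its evaluation at `φ₀` agrees with the measurable process only off a null set. -/
theorem outerExp_eq_integral {h g : Ω → ℝ} (hg : Measurable g) (hi : Integrable g μ)
    (hae : h =ᵐ[μ] g) : outerExp μ h = ∫ ω, g ω ∂μ := by
  refine IsLeast.csInf_eq ⟨⟨g, hg, hi, hae.le, rfl⟩, ?_⟩
  rintro r ⟨U, -, hUi, hle, rfl⟩
  refine integral_mono_ae hi hUi ?_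
  filter_upwards [hle, hae] with ω h1 h2 using h2 ▸ h1

/-- Markov's inequality for outer expectations. -/
theorem mul_measure_le_outerExp [IsProbabilityMeasure μ] {h : Ω → ℝ} (h0 : ∀ ω, 0 ≤ h ω)
    (h1 : ∀ ω, h ω ≤ 1) (c : ℝ) :
    ENNReal.ofReal c * μ {ω | c ≤ h ω} ≤ ENNReal.ofReal (outerExp μ h) := by
  rcases le_or_gt c 0 with hc | hc
  · simp [ENNReal.ofReal_of_nonpos hc]
  rw [ENNReal.le_ofReal_iff_toReal_le (ENNReal.mul_ne_top ENNReal.ofReal_ne_top (measure_ne_top _ _))]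
  · refine le_csInf ⟨_, fun _ => 1, measurable_const, integrable_const _,
      Eventually.of_forall h1, rfl⟩ ?_
    rintro r ⟨U, hU, hUi, hle, rfl⟩
    have hU0 : 0 ≤ᵐ[μ] U := by filter_upwards [hle] with ω h2 using (h0 ω).trans h2
    have := mul_meas_ge_le_integral_of_nonneg hU0 hUi c
    rw [ENNReal.toReal_mul, ENNReal.toReal_ofReal hc.le]
    refine le_trans ?_ this
    gcongr
    refine ENNReal.toReal_mono (measure_ne_top _ _) (measure_mono_ae ?_)
    filter_upwards [hle] with ω h2 h3 using le_trans h3 h2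
  · refine Real.sInf_nonneg ?_
    rintro r ⟨U, hU, hUi, hle, rfl⟩
    refine integral_nonneg_of_ae ?_
    filter_upwards [hle] with ω h2 using (h0 ω).trans h2

end OuterIntegral

/-! ### Negligible sequences of sets -/

section Negligible

variable {Ω : ℕ → Type*} [∀ n, MeasurableSpace (Ω n)] {μ : ∀ n, Measure (Ω n)}

theorem tendsto_measure_zero_union {S T : ∀ n, Set (Ω n)}
    (hS : Tendsto (fun n => μ n (S n)) atTop (𝓝 0)) (hT : Tendsto (fun n => μ n (T n)) atTop (𝓝 0)) :
    Tendsto (fun n => μ n (S n ∪ T n)) atTop (𝓝 0) :=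
  tendsto_of_tendsto_of_tendsto_of_le_of_le tendsto_const_nhds (by simpa using hS.add hT)
    (fun _ => zero_le) fun _ => measure_union_le _ _

theorem tendsto_measure_zero_mono_ae {S T : ∀ n, Set (Ω n)}
    (hT : Tendsto (fun n => μ n (T n)) atTop (𝓝 0))
    (hST : ∀ᶠ n in atTop, ∀ᵐ ω ∂(μ n), ω ∈ S n → ω ∈ T n) :
    Tendsto (fun n => μ n (S n)) atTop (𝓝 0) :=
  tendsto_of_tendsto_of_tendsto_of_le_of_le' tendsto_const_nhds hT
    (Eventually.of_forall fun _ => zero_le)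
    (hST.mono fun _ h => measure_mono_ae h)

end Negligible

/-! ### Squared truncations -/

/-- The truncated square is the square of `min |t| K`, which is 1-Lipschitz in `t` with values in
`[0, K]`, where squaring is `2K`-Lipschitz. -/
theorem abs_min_sq_sub_min_sq_le {K : ℝ} (hK : 0 ≤ K) (a b : ℝ) :
    |min (a ^ 2) (K ^ 2) - min (b ^ 2) (K ^ 2)| ≤ 2 * K * |a - b| := by
  have key : ∀ t : ℝ, min (t ^ 2) (K ^ 2) = (min |t| K) ^ 2 := by
    intro t
    rcases le_total |t| K with h | h
    · rw [min_eq_left h, sq_abs, min_eq_left]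
      exact sq_le_sq' (by linarith [neg_abs_le t]) (by linarith [le_abs_self t])
    · rw [min_eq_right h, min_eq_right]
      rw [← sq_abs t]; gcongr
  rw [key, key, sq_sub_sq, abs_mul]
  have h1 : |min |a| K - min |b| K| ≤ |a - b| :=
    ((abs_min_sub_min_le_max _ _ _ _).trans (by simp)).trans (abs_abs_sub_abs_le a b)
  have h2 : |min |a| K + min |b| K| ≤ 2 * K := by
    rw [abs_of_nonneg (by positivity)]
    linarith [min_le_right |a| K, min_le_right |b| K]
  gcongr

/-- Truncated second moments of nearby functions are close. -/
theorem ofReal_min_sq_le {K : ℝ} (hK : 0 ≤ K) {ε : ℝ} (a b : ℝ) :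
    ENNReal.ofReal (min (a ^ 2) (K ^ 2)) ≤ ENNReal.ofReal (min (b ^ 2) (K ^ 2)) +
      (ENNReal.ofReal (2 * K * ε) + if ε ≤ |a - b| then ENNReal.ofReal (K ^ 2) else 0) := by
  split_ifs with h
  · exact (ENNReal.ofReal_le_ofReal (min_le_right _ _)).trans
      (le_add_left (le_add_left le_rfl))
  · push Not at h
    have h1 := abs_min_sq_sub_min_sq_le hK a b
    have h2 : 2 * K * |a - b| ≤ 2 * K * ε := by gcongr
    have h3 := le_abs_self (min (a ^ 2) (K ^ 2) - min (b ^ 2) (K ^ 2))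
    rw [add_zero]
    exact (ENNReal.ofReal_le_ofReal (by linarith)).trans ENNReal.ofReal_add_le

theorem outerLIntegral_min_sq_le {Ω : Type*} [MeasurableSpace Ω] {κ : Measure Ω}
    [IsProbabilityMeasure κ] {K : ℝ} (hK : 0 ≤ K) (ε : ℝ) (a b : Ω → ℝ) :
    outerLIntegral κ (fun w => ENNReal.ofReal (min (a w ^ 2) (K ^ 2))) ≤
      outerLIntegral κ (fun w => ENNReal.ofReal (min (b w ^ 2) (K ^ 2))) +
      (ENNReal.ofReal (2 * K * ε) + ENNReal.ofReal (K ^ 2) * κ {w | ε ≤ |a w - b w|}) := by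
  refine (outerLIntegral_mono fun w => ofReal_min_sq_le hK (ε := ε) (a w) (b w)).trans ?_
  refine (outerLIntegral_add_le _ _).trans (add_le_add le_rfl ?_)
  refine (outerLIntegral_add_le _ _).trans (add_le_add ?_ ?_)
  · rw [outerLIntegral_of_measurable measurable_const]; simp
  · refine le_trans (le_of_eq ?_) (outerLIntegral_indicator_const_le _ _)
    congr 1

theorem outerLIntegral_sq_le_truncation {Ω : Type*} [MeasurableSpace Ω] (κ : Measure Ω)
    (K : ℝ) (a : Ω → ℝ) :
    outerLIntegral κ (fun w => ENNReal.ofReal (a w ^ 2)) ≤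
      outerLIntegral κ (fun w => ENNReal.ofReal (min (a w ^ 2) (K ^ 2))) +
      outerLIntegral κ ({w | K ^ 2 ≤ a w ^ 2}.indicator fun w => ENNReal.ofReal (a w ^ 2)) := by
  refine le_trans (outerLIntegral_mono fun w => ?_) (outerLIntegral_add_le _ _)
  by_cases h : K ^ 2 ≤ a w ^ 2
  · rw [Set.indicator_of_mem (by exact h)]; exact le_add_self
  · rw [min_eq_left (le_of_not_ge h)]; exact le_self_add

theorem absDiff_le {a b d : ℝ≥0∞} (h1 : a ≤ b + d) (h2 : b ≤ a + d) : absDiff a b ≤ d + d :=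
  add_le_add (tsub_le_iff_left.2 h1) (tsub_le_iff_left.2 h2)

/-- Subadditivity of the square root; the factor two pays for the two truncated differences in
`absDiff`. -/
theorem absDiff_rpow_half_le (a b : ℝ≥0∞) :
    absDiff (a ^ (1 / 2 : ℝ)) (b ^ (1 / 2 : ℝ)) ≤
      absDiff a b ^ (1 / 2 : ℝ) + absDiff a b ^ (1 / 2 : ℝ) := by
  have key : ∀ a b : ℝ≥0∞, a ^ (1 / 2 : ℝ) ≤ b ^ (1 / 2 : ℝ) + absDiff a b ^ (1 / 2 : ℝ) := by
    intro a b
    refine le_trans ?_ (ENNReal.rpow_add_le_add_rpow _ _ (by norm_num) (by norm_num))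
    refine ENNReal.rpow_le_rpow ?_ (by norm_num)
    exact (tsub_le_iff_left (a := a) (b := b)).1 le_self_add
  refine absDiff_le (key a b) ?_
  have := key b a
  rwa [show absDiff b a = absDiff a b from add_comm _ _] at this

theorem integral_sub_sq_of_memLp {Ω : Type*} [MeasurableSpace Ω] {μ : Measure Ω} {X Y : Ω → ℝ}
    (hX : MemLp X 2 μ) (hY : MemLp Y 2 μ) : ∫ ω, (X ω - Y ω) ^ 2 ∂μ =
      ∫ ω, X ω * X ω ∂μ - 2 * ∫ ω, X ω * Y ω ∂μ + ∫ ω, Y ω * Y ω ∂μ := by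
  have hXX : Integrable (fun ω => X ω * X ω) μ := hX.integrable_mul hX
  have hXY : Integrable (fun ω => 2 * (X ω * Y ω)) μ := (hX.integrable_mul hY).const_mul 2
  have hYY : Integrable (fun ω => Y ω * Y ω) μ := hY.integrable_mul hY
  have hd : Integrable (fun ω => X ω * X ω - 2 * (X ω * Y ω)) μ := hXX.sub hXY
  rw [← integral_const_mul, ← integral_sub hXX hXY, ← integral_add hd hYY]
  congr 1; ext ω; ring

/-! ### Sample paths of the Brownian bridge -/

namespace EllInf

variable {𝒳 : Type*} {F : Set (𝒳 → ℝ)}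

theorem abs_apply_sub_le (z z' : EllInf F) (f : F) : |z f - z' f| ≤ dist z z' := by
  rw [dist_eq_norm, ← Real.norm_eq_abs]
  exact lp.norm_apply_le_norm ENNReal.top_ne_zero (z - z') f

theorem lipschitzWith_apply (f : F) : LipschitzWith 1 fun z : EllInf F => z f :=
  LipschitzWith.of_dist_le_mul fun z z' => by
    rw [Real.dist_eq]; simpa using abs_apply_sub_le z z' f

theorem measurable_apply (f : F) : Measurable fun z : EllInf F => z f :=
  (lipschitzWith_apply f).continuous.measurable

end EllInf

theorem toEllInf_apply {𝒳 : Type*} {F : Set (𝒳 → ℝ)} {z : F → ℝ}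
    (hz : Memℓp (E := fun _ : F => ℝ) z ∞) (f : F) : toEllInf F z f = z f := by
  rw [toEllInf, dif_pos hz]

section Bridge

variable {𝒳 : Type*} [MeasurableSpace 𝒳] {P : Measure 𝒳} {F : Set (𝒳 → ℝ)}

/-- The (truncated, halved) oscillation of `z` over the `L₂(P)`-ball of radius `δ` around `f₀`. -/
noncomputable def localOsc (P : Measure 𝒳) (f₀ : F) (δ : ℝ) (z : EllInf F) : ℝ :=
  ⨆ f : {f : F // eLpNorm (f.1 - f₀.1) 2 P < ENNReal.ofReal δ}, min 1 (|z f.1 - z f₀| / 2)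

theorem bddAbove_localOsc (f₀ : F) (δ : ℝ) (z : EllInf F) :
    BddAbove (Set.range fun f : {f : F // eLpNorm (f.1 - f₀.1) 2 P < ENNReal.ofReal δ} =>
      min 1 (|z f.1 - z f₀| / 2)) :=
  ⟨1, by rintro _ ⟨f, rfl⟩; exact min_le_left _ _⟩

theorem localOsc_nonneg (f₀ : F) (δ : ℝ) (z : EllInf F) : 0 ≤ localOsc P f₀ δ z :=
  Real.iSup_nonneg fun _ => by positivity

theorem localOsc_le {f₀ : F} {δ : ℝ} {z : EllInf F} {c : ℝ} (hc : 0 ≤ c)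
    (h : ∀ f : F, eLpNorm (f.1 - f₀.1) 2 P < ENNReal.ofReal δ → min 1 (|z f - z f₀| / 2) ≤ c) :
    localOsc P f₀ δ z ≤ c :=
  Real.iSup_le (fun f => h f.1 f.2) hc

theorem localOsc_le_one (f₀ : F) (δ : ℝ) (z : EllInf F) : localOsc P f₀ δ z ≤ 1 :=
  localOsc_le zero_le_one fun _ _ => min_le_left _ _

theorem le_localOsc {f₀ f : F} {δ : ℝ} (z : EllInf F)
    (hf : eLpNorm (f.1 - f₀.1) 2 P < ENNReal.ofReal δ) :
    min 1 (|z f - z f₀| / 2) ≤ localOsc P f₀ δ z :=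
  le_ciSup (bddAbove_localOsc f₀ δ z) ⟨f, hf⟩

/-- Moving the path by `d` changes an increment by at most `2 * d`; the halving in `localOsc` brings
the constant down to one. -/
theorem lipschitzWith_localOsc (f₀ : F) (δ : ℝ) : LipschitzWith 1 (localOsc P f₀ δ) := by
  refine LipschitzWith.of_le_add fun z z' => ?_
  refine localOsc_le (add_nonneg (localOsc_nonneg _ _ _) dist_nonneg) fun f hf => ?_
  refine le_trans ?_ (add_le_add (le_localOsc z' hf) le_rfl)
  have h1 := EllInf.abs_apply_sub_le z z' f
  have h2 := EllInf.abs_apply_sub_le z z' f₀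
  have h3 : |z f - z f₀| ≤ |z' f - z' f₀| + 2 * dist z z' := by
    rw [abs_le] at *
    constructor <;> cases abs_cases (z' f - z' f₀) <;> linarith
  rcases min_cases 1 (|z' f - z' f₀| / 2) with h | h
  · rw [h.1]; exact (min_le_left _ _).trans (by linarith [dist_nonneg (x := z) (y := z')])
  · rw [h.1]; exact (min_le_right _ _).trans (by linarith)

theorem localOsc_mem_BL1 (f₀ : F) (δ : ℝ) : localOsc P f₀ δ ∈ BL1 (EllInf F) :=
  ⟨lipschitzWith_localOsc f₀ δ, fun z => by
    rw [abs_of_nonneg (localOsc_nonneg _ _ _)]; exact localOsc_le_one _ _ _⟩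

namespace IsBrownianBridge

variable {ν : Measure (EllInf F)}

theorem memLp_apply (h : IsBrownianBridge P F ν) (f : F) : MemLp (fun z : EllInf F => z f) 2 ν :=
  (h.gaussian.hasGaussianLaw_eval f).memLp_two

/-- By the covariance formula the left side is the `P`-variance of `f - g`, that is, the second
moment minus a squared mean. -/
theorem integral_sq_sub_le [IsProbabilityMeasure P] (h : IsBrownianBridge P F ν) (f g : F) :
    ENNReal.ofReal (∫ z : EllInf F, (z f - z g) ^ 2 ∂ν) ≤ eLpNorm (f.1 - g.1) 2 P ^ 2 := by
  have hf := h.memLp f.1 f.2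
  have hg := h.memLp g.1 g.2
  have e1 := integral_sub_sq_of_memLp (h.memLp_apply f) (h.memLp_apply g)
  have e2 := integral_sub_sq_of_memLp hf hg
  have e3 : ∫ z : EllInf F, (z f - z g) ^ 2 ∂ν ≤ ∫ x, (f.1 x - g.1 x) ^ 2 ∂P := by
    rw [e1, e2, h.cov, h.cov, h.cov]
    nlinarith [sq_nonneg (∫ x, f.1 x ∂P - ∫ x, g.1 x ∂P)]
  refine (ENNReal.ofReal_le_ofReal e3).trans (le_of_eq ?_)
  have hi : Integrable (fun x => (f.1 x - g.1 x) ^ 2) P := (hf.sub hg).integrable_sq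
  rw [ofReal_integral_eq_lintegral_ofReal hi (Eventually.of_forall fun _ => sq_nonneg _), ← ENNReal.rpow_natCast,
    eLpNorm_eq_lintegral_rpow_enorm_toReal two_ne_zero ENNReal.ofNat_ne_top, ← ENNReal.rpow_mul]
  norm_num
  refine lintegral_congr fun x => ?_
  rw [← sq_abs, ENNReal.ofReal_pow (abs_nonneg _), ← Real.enorm_eq_ofReal_abs]

theorem measure_abs_sub_ge_le [IsProbabilityMeasure P] (h : IsBrownianBridge P F ν) (f g : F)
    {ε : ℝ} (hε : 0 < ε) :
    ENNReal.ofReal (ε ^ 2) * ν {z | ε ≤ |z f - z g|} ≤ eLpNorm (f.1 - g.1) 2 P ^ 2 := by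
  have := h.isProbabilityMeasure
  have hi : Integrable (fun z : EllInf F => (z f - z g) ^ 2) ν :=
    ((h.memLp_apply f).sub (h.memLp_apply g)).integrable_sq
  refine le_trans ?_ (h.integral_sq_sub_le f g)
  rw [ofReal_integral_eq_lintegral_ofReal hi (Eventually.of_forall fun _ => sq_nonneg _)]
  refine le_trans ?_ (mul_meas_ge_le_lintegral
    (((EllInf.measurable_apply f).sub (EllInf.measurable_apply g)).pow_const 2).ennreal_ofReal
    (ENNReal.ofReal (ε ^ 2)))
  gcongr _ * ν ?_
  intro z hz
  refine ENNReal.ofReal_le_ofReal ?_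
  have : ε ≤ |z f - z g| := hz
  calc ε ^ 2 ≤ |z f - z g| ^ 2 := by gcongr
    _ = _ := sq_abs _

/-- The paths of a tight Brownian bridge are, with large probability, uniformly close to their
value at `f₀` on small `L₂(P)`-balls around `f₀`. -/
theorem exists_integral_localOsc_le [IsProbabilityMeasure P] (h : IsBrownianBridge P F ν) (f₀ : F)
    {η : ℝ} (hη : 0 < η) : ∃ δ : ℝ, 0 < δ ∧ ∫ z, localOsc P f₀ δ z ∂ν ≤ η := by
  have := h.isProbabilityMeasure
  -- Half of `η` covers the oscillation bound `3 * ε`, the other half the exceptional set.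
  set ε : ℝ := η / 6 with hεdef
  have hε : 0 < ε := by positivity
  obtain ⟨K, hK, hKν⟩ := isTightMeasureSet_iff_exists_isCompact_measure_compl_le.1 h.tight
    (ENNReal.ofReal (η / 2)) (by simpa using hη)
  replace hKν := hKν ν rfl
  obtain ⟨t, -, htfin, htK⟩ := hK.finite_cover_balls hε
  -- Only the charged balls of the finite cover matter; being finitely many, their masses have a
  -- common positive lower bound `p`.
  set s := {z ∈ t | ν (Metric.ball z ε) ≠ 0} with hs
  have hsfin : s.Finite := htfin.subset (Set.sep_subset _ _)
  obtain ⟨p, hp0, hp⟩ : ∃ p : ℝ, 0 < p ∧ ∀ z ∈ s, ENNReal.ofReal p < ν (Metric.ball z ε) := by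
    have hev : ∀ᶠ p : ℝ in 𝓝[>] 0, ∀ z ∈ s, ENNReal.ofReal p < ν (Metric.ball z ε) := by
      rw [eventually_all_finite hsfin]
      intro z hz
      have : Tendsto ENNReal.ofReal (𝓝[>] 0) (𝓝 0) := by
        simpa using (ENNReal.continuous_ofReal.tendsto 0).mono_left nhdsWithin_le_nhds
      exact this.eventually (gt_mem_nhds (pos_iff_ne_zero.2 hz.2))
    obtain ⟨p, hp, hp0⟩ := (hev.and self_mem_nhdsWithin).exists
    exact ⟨p, hp0, hp⟩
  -- With this radius, Chebyshev bounds the probability of an increment of size `ε` by `p`, less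
  -- than the mass of any charged ball.
  refine ⟨ε * √p, by positivity, ?_⟩
  have hosc : ∀ z₀ ∈ s, ∀ z ∈ Metric.ball z₀ ε, localOsc P f₀ (ε * √p) z ≤ 3 * ε := by
    intro z₀ hz₀ z hz
    refine localOsc_le (by positivity) fun f hf => (min_le_right _ _).trans ?_
    -- The path `z'` may depend on `f`, yet the bound is uniform in `f`: every path of the ball is
    -- within `2 * ε` of `z'` in supremum norm.
    obtain ⟨z', hz', hlt⟩ : ∃ z' ∈ Metric.ball z₀ ε, |z' f - z' f₀| < ε := by
      by_contra! hcon
      have h1 : ν (Metric.ball z₀ ε) ≤ ν {z | ε ≤ |z f - z f₀|} := measure_mono hcon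
      have h2 := h.measure_abs_sub_ge_le f f₀ hε
      have h3 : eLpNorm (f.1 - f₀.1) 2 P ^ 2 ≤ ENNReal.ofReal (ε ^ 2) * ENNReal.ofReal p := by
        rw [← ENNReal.ofReal_mul (by positivity), show ε ^ 2 * p = (ε * √p) ^ 2 by
          rw [mul_pow, Real.sq_sqrt hp0.le], ENNReal.ofReal_pow (by positivity)]
        gcongr
      have h4 := (ENNReal.mul_le_mul_iff_right (by simpa using hε.ne')
        ENNReal.ofReal_ne_top).1 (h2.trans h3)
      exact absurd (hp z₀ hz₀) (not_lt.2 (h1.trans h4))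
    have hd : dist z z' < 2 * ε := by
      have := dist_triangle_right z z' z₀
      rw [Metric.mem_ball] at hz hz'; linarith
    have h1 := EllInf.abs_apply_sub_le z z' f
    have h2 := EllInf.abs_apply_sub_le z z' f₀
    have h3 : |z f - z f₀| ≤ 6 * ε := by
      rw [abs_le] at *
      rw [abs_lt] at hlt
      constructor <;> linarith
    linarith
  set N : Set (EllInf F) := toMeasurable ν Kᶜ ∪ ⋃ z ∈ t \ s, Metric.ball z ε with hN
  have hNm : MeasurableSet N := (measurableSet_toMeasurable _ _).union
    ((htfin.subset Set.sdiff_subset).measurableSet_biUnion fun _ _ => measurableSet_ball)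
  have hNν : ν.real N ≤ η / 2 := by
    refine ENNReal.toReal_le_of_le_ofReal (by positivity) ?_
    have h0 : ν (⋃ z ∈ t \ s, Metric.ball z ε) = 0 := by
      rw [measure_biUnion_null_iff (htfin.subset Set.sdiff_subset).countable]
      intro z hz
      by_contra hne
      exact hz.2 ⟨hz.1, hne⟩
    refine (measure_union_le _ _).trans ?_
    rw [h0, measure_toMeasurable, add_zero]
    exact hKν
  have hbound : ∀ z, localOsc P f₀ (ε * √p) z ≤ 3 * ε + N.indicator (fun _ => 1) z := by
    intro z
    by_cases hz : z ∈ N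
    · rw [Set.indicator_of_mem hz]
      linarith [localOsc_le_one (P := P) f₀ (ε * √p) z]
    · rw [Set.indicator_of_notMem hz, add_zero]
      have hzK : z ∈ K := by
        by_contra hzK
        exact hz (Or.inl (subset_toMeasurable _ _ hzK))
      obtain ⟨z₀, hz₀, hzb⟩ := Set.mem_iUnion₂.1 (htK hzK)
      refine hosc z₀ ?_ z hzb
      by_contra hns
      exact hz (Or.inr (Set.mem_biUnion (show z₀ ∈ t \ s from ⟨hz₀, hns⟩) hzb))
  have hNi : Integrable (N.indicator fun _ => (1 : ℝ)) ν := (integrable_const 1).indicator hNm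
  calc ∫ z, localOsc P f₀ (ε * √p) z ∂ν
      ≤ ∫ z, (3 * ε + N.indicator (fun _ => 1) z) ∂ν := by
        refine integral_mono_of_nonneg (Eventually.of_forall fun z => localOsc_nonneg _ _ _)
          ((integrable_const _).add hNi) (Eventually.of_forall hbound)
    _ = 3 * ε + ν.real N := by
        rw [integral_add (integrable_const _) hNi, integral_indicator_const _ hNm]; simp
    _ ≤ η := by rw [hεdef]; linarith

theorem map_apply (h : IsBrownianBridge P F ν) {f : F} (hf : ∫ x, f.1 x ∂P = 0) :
    ν.map (fun z : EllInf F => z f) = gaussianReal 0 (∫ x, f.1 x ^ 2 ∂P).toNNReal := by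
  have := h.isProbabilityMeasure
  rw [(h.gaussian.hasGaussianLaw_eval f).map_eq_gaussianReal, h.mean f,
    variance_of_integral_eq_zero (EllInf.measurable_apply f).aemeasurable (h.mean f)]
  have := h.cov f f
  simp only [hf, ← pow_two] at this
  rw [this]; simp

end IsBrownianBridge

end Bridge

theorem ENNReal.tendsto_zero_of_forall_ofReal {f : ℕ → ℝ≥0∞}
    (h : ∀ η : ℝ, 0 < η → ∀ᶠ n in atTop, f n ≤ ENNReal.ofReal η) : Tendsto f atTop (𝓝 0) := by
  rw [ENNReal.tendsto_nhds_zero]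
  intro ε hε
  rcases eq_or_ne ε ∞ with rfl | hne
  · exact Eventually.of_forall fun _ => le_top
  · have := h ε.toReal (ENNReal.toReal_pos hε.ne' hne)
    rwa [ENNReal.ofReal_toReal hne] at this

theorem ENNReal.le_ofReal_of_mul_le {c η : ℝ} {m : ℝ≥0∞} (hc : 0 < c)
    (h : ENNReal.ofReal c * m ≤ ENNReal.ofReal (c * η)) : m ≤ ENNReal.ofReal η := by
  rw [ENNReal.ofReal_mul hc.le] at h
  exact (ENNReal.mul_le_mul_iff_right (by simpa using hc) ENNReal.ofReal_ne_top).1 h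

/-! ### Process increments at random functions -/

section Increments

variable {𝒳 : Type*} [MeasurableSpace 𝒳] {F : Set (𝒳 → ℝ)}

/-- The event that a random function `g` lies in `F`, close to `f₀`, while the process `D` takes
distant values at `g` and at `f₀`. -/
def incrementSet {Ω : Type*} (P : Measure 𝒳) (f₀ : F) (D : Ω → EllInf F) (g : Ω → 𝒳 → ℝ)
    (δ ε : ℝ) : Set Ω :=
  {w | ∃ hg : g w ∈ F, eLpNorm (g w - f₀.1) 2 P < ENNReal.ofReal δ ∧
    ε ≤ |D w ⟨g w, hg⟩ - D w f₀|}

theorem mul_measure_incrementSet_le {Ω : Type*} [MeasurableSpace Ω] (κ : Measure Ω)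
    [IsProbabilityMeasure κ] (P : Measure 𝒳) (f₀ : F) (D : Ω → EllInf F) (g : Ω → 𝒳 → ℝ)
    (δ ε : ℝ) :
    ENNReal.ofReal (min 1 (ε / 2)) * κ (incrementSet P f₀ D g δ ε) ≤
      ENNReal.ofReal (outerExp κ fun w => localOsc P f₀ δ (D w)) := by
  refine le_trans ?_ (mul_measure_le_outerExp (fun w => localOsc_nonneg _ _ _)
    (fun w => localOsc_le_one _ _ _) (min 1 (ε / 2)))
  gcongr _ * κ ?_
  rintro w ⟨hg, hlt, hle⟩
  exact le_trans (min_le_min le_rfl (by linarith)) (le_localOsc (D w) (f := ⟨g w, hg⟩) hlt)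

/-- By the triangle inequality either `r` or the increment of `G` accounts for half of `ε`; the
remaining sets collect the ways in which the increment can be large. -/
theorem mem_of_le_abs_sub {Ω : Type*} {P : Measure 𝒳} {f₀ : F} {D : Ω → EllInf F}
    {g : Ω → 𝒳 → ℝ} {G : Ω → (𝒳 → ℝ) → ℝ} {δ ε r : ℝ} {w : Ω}
    (hD : ∀ f : F, D w f = G w f) (h : ε ≤ |r + G w (g w) - G w f₀|) :
    w ∈ {_w | ε / 2 ≤ |r|} ∪ ({w | g w ∉ F} ∪
      ({w | ENNReal.ofReal δ ≤ eLpNorm (g w - f₀.1) 2 P} ∪ incrementSet P f₀ D g δ (ε / 2))) := by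
  by_cases h1 : ε / 2 ≤ |r|
  · exact Or.inl h1
  by_cases h2 : g w ∈ F
  swap
  · exact Or.inr (Or.inl h2)
  by_cases h3 : ENNReal.ofReal δ ≤ eLpNorm (g w - f₀.1) 2 P
  · exact Or.inr (Or.inr (Or.inl h3))
  refine Or.inr (Or.inr (Or.inr ⟨h2, not_le.1 h3, ?_⟩))
  rw [hD, hD]
  have := abs_add_le r (G w (g w) - G w f₀)
  rw [← add_sub_assoc] at this
  push Not at h1
  linarith

end Increments

/-! ### Asymptotic linearity of the estimator and its bootstrap version -/

namespace BootstrapFramework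

variable {𝒳 H : Type*} [MeasurableSpace 𝒳] (B : BootstrapFramework 𝒳 H)

instance isProbabilityMeasure_dataLaw (n : ℕ) : IsProbabilityMeasure (B.dataLaw n) := by
  unfold dataLaw; infer_instance

instance isProbabilityMeasure_bootLaw (n : ℕ) : IsProbabilityMeasure (B.bootLaw n) := by
  unfold bootLaw; infer_instance

/-- Asymptotic linearity of the estimator. -/
theorem tendsto_measure_estimator_sub_empProc (hA1 : B.CondA1) (hA2 : B.CondA2) (hA3 : B.CondA3)
    {ε : ℝ} (hε : 0 < ε) :
    Tendsto (fun n => B.dataLaw n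
      {x | ε ≤ |√(n : ℝ) * (B.ψ n x - B.ψ₀) - B.empProc n x B.φ₀|}) atTop (𝓝 0) := by
  obtain ⟨F, -, hφ₀, hφF, hmem, ν, hν, hconv⟩ := hA1
  set f₀ : F := ⟨B.φ₀, hφ₀⟩
  refine ENNReal.tendsto_zero_of_forall_ofReal fun η hη => ?_
  -- The value that `localOsc` reaches when an increment is at least `ε / 2`.
  set c : ℝ := min 1 (ε / 2 / 2)
  have hc : 0 < c := by positivity
  obtain ⟨δ, hδ, hosc⟩ := hν.exists_integral_localOsc_le f₀ (η := c * (η / 2) / 2) (by positivity)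
  set D : ∀ n, (Fin n → 𝒳) → EllInf F := fun n x => toEllInf F fun f : F => B.empProc n x f
  have hincr : ∀ᶠ n in atTop,
      B.dataLaw n (incrementSet B.P₀ f₀ (D n) (B.φ n) δ (ε / 2)) ≤ ENNReal.ofReal (η / 2) := by
    let h : EllInf F →ᵇ ℝ := BoundedContinuousFunction.ofNormedAddCommGroup
      (localOsc (B.P₀ : Measure 𝒳) f₀ δ) (lipschitzWith_localOsc f₀ δ).continuous 1
      (fun z => (localOsc_mem_BL1 f₀ δ).2 z)
    have hlt : ∫ z, localOsc (B.P₀ : Measure 𝒳) f₀ δ z ∂ν < c * (η / 2) :=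
      lt_of_le_of_lt hosc (half_lt_self (by positivity))
    filter_upwards [(hconv h).eventually (gt_mem_nhds hlt)] with n hn
    refine ENNReal.le_ofReal_of_mul_le hc ?_
    exact (mul_measure_incrementSet_le _ _ f₀ _ _ δ (ε / 2)).trans (ENNReal.ofReal_le_ofReal hn.le)
  have hrest : Tendsto (fun n => B.dataLaw n
      ({x | ENNReal.ofReal (ε / 2) ≤ ENNReal.ofReal |√(n : ℝ) * B.R n x|} ∪ ({x | B.φ n x ∉ F} ∪
        {x | ENNReal.ofReal δ ≤ eLpNorm (B.φ n x - B.φ₀) 2 (B.P₀ : Measure 𝒳)}))) atTop (𝓝 0) :=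
    tendsto_measure_zero_union (hA3 _ (by positivity))
      (tendsto_measure_zero_union hφF (hA2 δ hδ))
  filter_upwards [hincr, hmem, ENNReal.tendsto_nhds_zero.1 hrest (ENNReal.ofReal (η / 2))
    (by simpa using hη)] with n h1 h2 h3
  rw [← add_halves η, ENNReal.ofReal_add (by positivity) (by positivity)]
  refine le_trans (measure_mono_ae ?_) ((measure_union_le _ _).trans (add_le_add h3 h1))
  filter_upwards [h2] with x hx hle
  have key := mem_of_le_abs_sub (P := B.P₀) (f₀ := f₀) (D := D n) (g := B.φ n)
    (G := fun x f => B.empProc n x f) (δ := δ) (ε := ε) (r := √(n : ℝ) * B.R n x)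
    (fun f => toEllInf_apply hx f) (le_of_le_of_eq hle (by
      congr 1; simp only [R, empProc, f₀]; ring))
  rcases key with h | h | h | h
  · exact Or.inl (Or.inl (ENNReal.ofReal_le_ofReal h))
  · exact Or.inl (Or.inr (Or.inl h))
  · exact Or.inl (Or.inr (Or.inr h))
  · exact Or.inr h

/-- Conditional asymptotic linearity of the bootstrap estimator. -/
theorem condConvOuterProb_Tstar_sub_bootProc (hB1 : B.CondB1) (hB2 : B.CondB2) (hB3 : B.CondB3) :
    CondConvOuterProb B.dataLaw B.bootLaw
      (fun n x w => ENNReal.ofReal |B.Tstar n x w - B.bootProc n x w B.φ₀|) := by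
  obtain ⟨F, -, hφ₀, hφF, hmem, ν, hν, hconv⟩ := hB1
  set f₀ : F := ⟨B.φ₀, hφ₀⟩
  intro ε hε θ hθ
  set c : ℝ := min 1 (ε / 2 / 2)
  have hc : 0 < c := by positivity
  -- Four causes of failure get `θ / 4` each; `θ / 5` makes the last bound strict. The bridge
  -- expectation and the weak convergence error each use half of `c * (θ / 5)`.
  obtain ⟨δ, hδ, hosc⟩ := hν.exists_integral_localOsc_le f₀ (η := c * (θ / 5) / 2) (by positivity)
  set D : ∀ n, (Fin n → 𝒳) → (Fin n → B.W n) → EllInf F :=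
    fun n x w => toEllInf F fun f : F => B.bootProc n x w f
  have hbad := tendsto_measure_zero_union (hB3 (ε / 2) (by positivity) (θ / 4) (by positivity))
    (tendsto_measure_zero_union (hφF (θ / 4) (by positivity))
      (tendsto_measure_zero_union (hB2 δ hδ (θ / 4) (by positivity))
        (hconv (c * (θ / 5) / 2) (by positivity))))
  refine tendsto_measure_zero_mono_ae hbad ?_
  filter_upwards [hmem] with n hn
  filter_upwards [hn] with x hx hle
  by_contra hcon
  simp only [Set.mem_union, Set.mem_ofPred_eq, not_or, not_le] at hcon
  obtain ⟨h1, h2, h3, h4⟩ := hcon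
  have h5 : B.bootLaw n (incrementSet B.P₀ f₀ (D n x) (B.φboot n x) δ (ε / 2)) <
      ENNReal.ofReal (θ / 4) := by
    refine lt_of_le_of_lt (b := ENNReal.ofReal (θ / 5)) (ENNReal.le_ofReal_of_mul_le hc ?_)
      ((ENNReal.ofReal_lt_ofReal_iff (by positivity)).2 (by linarith))
    refine (mul_measure_incrementSet_le _ _ f₀ _ _ δ (ε / 2)).trans (ENNReal.ofReal_le_ofReal ?_)
    have h6 := lt_of_le_of_lt (le_iSup₂ (f := fun h (_ : h ∈ BL1 (EllInf F)) =>
      ENNReal.ofReal |outerExp (B.bootLaw n) (fun w => h (D n x w)) - ∫ z, h z ∂ν|)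
      (localOsc (B.P₀ : Measure 𝒳) f₀ δ) (localOsc_mem_BL1 f₀ δ)) h4
    rw [ENNReal.ofReal_lt_ofReal_iff (by positivity), abs_lt] at h6
    linarith [h6.2]
  refine absurd hle (not_le.2 ?_)
  have hsum : ENNReal.ofReal θ = ENNReal.ofReal (θ / 4) + (ENNReal.ofReal (θ / 4) +
      (ENNReal.ofReal (θ / 4) + ENNReal.ofReal (θ / 4))) := by
    have h0 : 0 ≤ θ / 4 := by positivity
    rw [← ENNReal.ofReal_add h0 h0, ← ENNReal.ofReal_add h0 (by positivity),
      ← ENNReal.ofReal_add h0 (by positivity)]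
    congr 1; ring
  rw [hsum]
  refine lt_of_le_of_lt ?_ (ENNReal.add_lt_add h1 (ENNReal.add_lt_add h2
    (ENNReal.add_lt_add h3 h5)))
  refine le_trans (measure_mono_ae (t := _ ∪ (_ ∪ (_ ∪ _))) ?_)
    ((measure_union_le _ _).trans (add_le_add le_rfl
      ((measure_union_le _ _).trans (add_le_add le_rfl (measure_union_le _ _)))))
  filter_upwards [hx.2] with w hw hle'
  have hle'' : ε ≤ |B.Tstar n x w - B.bootProc n x w B.φ₀| :=
    (ENNReal.ofReal_le_ofReal_iff (abs_nonneg _)).1 hle'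
  have key := mem_of_le_abs_sub (P := B.P₀) (f₀ := f₀) (D := D n x) (g := B.φboot n x)
    (G := fun w f => B.bootProc n x w f) (δ := δ) (ε := ε) (r := √(n : ℝ) * B.Rs n x w)
    (fun f => toEllInf_apply hw f) (le_of_le_of_eq hle'' (by
      congr 1; simp only [Rs, Tstar, bootProc, f₀]; ring))
  rcases key with h | h | h | h
  · exact Or.inl (ENNReal.ofReal_le_ofReal h)
  · exact Or.inr (Or.inl h)
  · exact Or.inr (Or.inr (Or.inl h))
  · exact Or.inr (Or.inr (Or.inr h))

end BootstrapFramework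

/-! ### Truncated second moments and the bootstrap variance -/

theorem tendsto_integral_min_sq {Ω : Type*} [MeasurableSpace Ω] {ν : Measure Ω} {Z : Ω → ℝ}
    (hZm : Measurable Z) (hZ : MemLp Z 2 ν) :
    Tendsto (fun m : ℕ => ∫ ω, min (Z ω ^ 2) m ∂ν) atTop (𝓝 (∫ ω, Z ω ^ 2 ∂ν)) := by
  refine tendsto_integral_of_dominated_convergence (fun ω => Z ω ^ 2)
    (fun m => ((hZm.pow_const 2).min measurable_const).aestronglyMeasurable) hZ.integrable_sq
    (fun m => Eventually.of_forall fun ω => ?_) (Eventually.of_forall fun ω => ?_)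
  · rw [Real.norm_of_nonneg (by positivity)]
    exact min_le_left _ _
  · refine tendsto_const_nhds.congr' ?_
    filter_upwards [tendsto_natCast_atTop_atTop.eventually_ge_atTop (Z ω ^ 2)] with m hm
    exact (min_eq_left hm).symm

/-- In the divisor, `2 * K` absorbs the Lipschitz constant, `K ^ 2` the supremum, and `1` ensures
positivity. -/
theorem min_sq_div_mem_BL1 {𝒳 : Type*} {F : Set (𝒳 → ℝ)} (f : F) {K : ℝ} (hK : 0 ≤ K) :
    (fun z : EllInf F => min (z f ^ 2) (K ^ 2) / (2 * K + K ^ 2 + 1)) ∈ BL1 (EllInf F) := by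
  have hC : 0 < 2 * K + K ^ 2 + 1 := by positivity
  constructor
  · refine LipschitzWith.of_dist_le_mul fun z z' => ?_
    rw [Real.dist_eq, ← sub_div, abs_div, abs_of_pos hC, div_le_iff₀ hC, NNReal.coe_one, one_mul]
    have h1 := abs_min_sq_sub_min_sq_le hK (z f) (z' f)
    have h2 := EllInf.abs_apply_sub_le z z' f
    have h3 : 2 * K * |z f - z' f| ≤ dist z z' * (2 * K) := by
      rw [mul_comm]; gcongr
    have h4 : 0 ≤ dist z z' * (K ^ 2 + 1) := by positivity
    linarith
  · intro z
    rw [abs_of_nonneg (by positivity), div_le_one hC]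
    linarith [min_le_right (z f ^ 2) (K ^ 2)]

namespace BootstrapFramework

variable {𝒳 H : Type*} [MeasurableSpace 𝒳] (B : BootstrapFramework 𝒳 H)

theorem measurable_bootProc {f : 𝒳 → ℝ} (hf : Measurable f) (n : ℕ) (x : Fin n → 𝒳) :
    Measurable fun w => B.bootProc n x w f := by
  have hγ : Measurable (B.γ n x) := (B.measurable_γ n).of_uncurry_left
  unfold bootProc empMean bootSample
  refine measurable_const.mul (Measurable.sub_const (Measurable.div_const ?_ _) _)
  exact Finset.measurable_sum _ fun i _ => hf.comp (hγ.comp (measurable_pi_apply i))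

theorem measurable_empProc {f : 𝒳 → ℝ} (hf : Measurable f) (n : ℕ) :
    Measurable fun x => B.empProc n x f := by
  unfold empProc empMean
  refine measurable_const.mul (Measurable.sub_const (Measurable.div_const ?_ _) _)
  exact Finset.measurable_sum _ fun i _ => hf.comp (measurable_pi_apply i)

theorem integral_bridge_sq {F : Set (𝒳 → ℝ)} {ν : Measure (EllInf F)}
    (hν : IsBrownianBridge (B.P₀ : Measure 𝒳) F ν) (hφ₀ : B.φ₀ ∈ F) :
    ∫ z : EllInf F, z ⟨B.φ₀, hφ₀⟩ ^ 2 ∂ν = B.σ₀sq := by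
  have := hν.cov ⟨B.φ₀, hφ₀⟩ ⟨B.φ₀, hφ₀⟩
  simp only [B.φ₀_mean, ← pow_two] at this
  rw [this, σ₀sq]; simp

/-- Consistency of the bootstrap variance. -/
theorem convOuterProb_σbarsq (hB1 : B.CondB1) (hB2 : B.CondB2) (hB3 : B.CondB3)
    (hT : B.AsympUnifSqIntegrable) :
    ConvOuterProb B.dataLaw
      (fun n x => absDiff (B.σbarsq n x) (ENNReal.ofReal B.σ₀sq)) := by
  have hlin := B.condConvOuterProb_Tstar_sub_bootProc hB1 hB2 hB3
  obtain ⟨F, hFm, hφ₀, -, hmem, ν, hν, hconv⟩ := hB1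
  have := hν.isProbabilityMeasure
  set f₀ : F := ⟨B.φ₀, hφ₀⟩
  set v := B.σ₀sq
  have hv : 0 ≤ v := integral_nonneg fun _ => sq_nonneg _
  have hvlim := tendsto_integral_min_sq (EllInf.measurable_apply f₀) (hν.memLp_apply f₀)
  rw [B.integral_bridge_sq hν hφ₀] at hvlim
  intro ε₀ hε₀
  refine ENNReal.tendsto_zero_of_forall_ofReal fun η hη => ?_
  -- Each one-sided error will be at most `5 * θ`, and `absDiff_le` doubles it, leaving `10 * θ <
  -- ε₀`.
  set θ : ℝ := ε₀ / 12 with hθdef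
  have hθ : 0 < θ := by positivity
  obtain ⟨m, hmtail, hmv⟩ := ((hT.eventually
    (gt_mem_nhds (ENNReal.ofReal_pos.2 (show 0 < θ * (η / 2) by positivity)))).and
    (hvlim.eventually (Metric.ball_mem_nhds v hθ))).exists
  obtain ⟨K, hK, hKm⟩ : ∃ K : ℝ, 0 ≤ K ∧ K ^ 2 = m := ⟨√m, Real.sqrt_nonneg _, by simp⟩
  rw [Real.dist_eq, ← hKm, abs_lt] at hmv
  simp only [← hKm] at hmtail
  set vK := ∫ z : EllInf F, min (z f₀ ^ 2) (K ^ 2) ∂ν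
  set C := 2 * K + K ^ 2 + 1
  have hC : 0 < C := by positivity
  -- Keeps the Lipschitz error `2 * K * ε` below `θ`; the level `θ / (K ^ 2 + 1)` below does the
  -- same for the event where linearization fails.
  set ε := θ / (2 * K + 1)
  have hε : 0 < ε := by positivity
  have hKε : 2 * K * ε ≤ θ := by
    rw [mul_div_assoc', div_le_iff₀ (by positivity)]; nlinarith
  have hbad := tendsto_measure_zero_union
    (hlin ε hε (θ / (K ^ 2 + 1)) (by positivity)) (hconv (θ / C) (by positivity))
  filter_upwards [eventually_lt_of_limsup_lt hmtail, hmem, ENNReal.tendsto_nhds_zero.1 hbad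
    (ENNReal.ofReal (η / 2)) (by simpa using hη)] with n htail hn hsmall
  set tail : (Fin n → 𝒳) → ℝ≥0∞ := fun x => outerLIntegral (B.bootLaw n)
    ({w | K ^ 2 ≤ B.Tstar n x w ^ 2}.indicator fun w => ENNReal.ofReal (B.Tstar n x w ^ 2))
  -- Markov over the data turns the bound on the iterated outer expectation into one on the
  -- conditional tail.
  have hmarkov : B.dataLaw n {x | ENNReal.ofReal θ ≤ tail x} ≤ ENNReal.ofReal (η / 2) :=
    ENNReal.le_ofReal_of_mul_le hθ ((mul_measure_le_outerLIntegral _ _).trans htail.le)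
  rw [← add_halves η, ENNReal.ofReal_add (by positivity) (by positivity)]
  refine le_trans (measure_mono_ae ?_) ((measure_union_le _ _).trans (add_le_add hsmall hmarkov))
  filter_upwards [hn] with x hx hle
  by_contra hcon
  obtain ⟨hcon, htx⟩ := not_or.1 hcon
  obtain ⟨hlinx, hconvx⟩ := not_or.1 hcon
  replace htx : tail x < ENNReal.ofReal θ := not_le.1 htx
  simp only [Set.mem_ofPred_eq, not_le] at hlinx hconvx
  set Y : (Fin n → B.W n) → ℝ := fun w => B.bootProc n x w B.φ₀
  have hY : Measurable Y := B.measurable_bootProc (hFm _ hφ₀) n x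
  have hYm : Measurable fun w => min (Y w ^ 2) (K ^ 2) := (hY.pow_const 2).min measurable_const
  have hYi : Integrable (fun w => min (Y w ^ 2) (K ^ 2)) (B.bootLaw n) := by
    refine Integrable.of_bound hYm.aestronglyMeasurable (K ^ 2) (Eventually.of_forall fun w => ?_)
    rw [Real.norm_of_nonneg (by positivity)]
    exact min_le_right _ _
  set y := ∫ w, min (Y w ^ 2) (K ^ 2) ∂(B.bootLaw n)
  have hy : |y - vK| < θ := by
    have h1 := lt_of_le_of_lt (le_iSup₂ (f := fun h (_ : h ∈ BL1 (EllInf F)) =>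
      ENNReal.ofReal |outerExp (B.bootLaw n)
        (fun w => h (toEllInf F fun f : F => B.bootProc n x w f)) - ∫ z, h z ∂ν|)
      _ (min_sq_div_mem_BL1 f₀ hK)) hconvx
    rw [ENNReal.ofReal_lt_ofReal_iff (by positivity),
      outerExp_eq_integral (hYm.div_const C) (hYi.div_const C), integral_div, integral_div,
      ← sub_div, abs_div, abs_of_pos hC] at h1
    · exact (div_lt_div_iff_of_pos_right hC).1 h1
    · filter_upwards [hx.2] with w hw
      rw [toEllInf_apply hw f₀]
  have hmeas : {w | ε ≤ |B.Tstar n x w - Y w|} ⊆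
      {w | ENNReal.ofReal ε ≤ ENNReal.ofReal |B.Tstar n x w - Y w|} :=
    fun w hw => ENNReal.ofReal_le_ofReal hw
  have herr : ENNReal.ofReal (2 * K * ε) + ENNReal.ofReal (K ^ 2) *
      B.bootLaw n {w | ε ≤ |B.Tstar n x w - Y w|} ≤ ENNReal.ofReal (2 * θ) := by
    rw [two_mul θ, ENNReal.ofReal_add hθ.le hθ.le]
    refine add_le_add (ENNReal.ofReal_le_ofReal hKε) ?_
    refine (mul_le_mul_right ((measure_mono hmeas).trans hlinx.le) _).trans ?_
    rw [← ENNReal.ofReal_mul (by positivity)]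
    refine ENNReal.ofReal_le_ofReal ?_
    rw [mul_div_assoc', div_le_iff₀ (by positivity)]; nlinarith
  have hYint : outerLIntegral (B.bootLaw n) (fun w => ENNReal.ofReal (min (Y w ^ 2) (K ^ 2))) =
      ENNReal.ofReal y := by
    rw [outerLIntegral_of_measurable hYm.ennreal_ofReal, ofReal_integral_eq_lintegral_ofReal hYi
      (Eventually.of_forall fun w => by positivity)]
  have hup := outerLIntegral_min_sq_le (κ := B.bootLaw n) hK ε (B.Tstar n x) Y
  have hlow := outerLIntegral_min_sq_le (κ := B.bootLaw n) hK ε Y (B.Tstar n x)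
  simp only [abs_sub_comm (Y _)] at hlow
  rw [hYint] at hup hlow
  have hy0 : 0 ≤ y := integral_nonneg fun w => by positivity
  rw [abs_lt] at hy
  have h5 : absDiff (B.σbarsq n x) (ENNReal.ofReal v) ≤
      ENNReal.ofReal (5 * θ) + ENNReal.ofReal (5 * θ) := by
    refine absDiff_le ?_ ?_
    · calc B.σbarsq n x ≤ _ := outerLIntegral_sq_le_truncation _ K _
        _ ≤ (ENNReal.ofReal y + ENNReal.ofReal (2 * θ)) + ENNReal.ofReal θ :=
          add_le_add (hup.trans (add_le_add le_rfl herr)) htx.le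
        _ = ENNReal.ofReal (y + 2 * θ + θ) := by
          rw [ENNReal.ofReal_add (by positivity) hθ.le, ENNReal.ofReal_add hy0 (by positivity)]
        _ ≤ ENNReal.ofReal (v + 5 * θ) := ENNReal.ofReal_le_ofReal (by linarith)
        _ = _ := ENNReal.ofReal_add hv (by positivity)
    · calc ENNReal.ofReal v ≤ ENNReal.ofReal (y + 2 * θ) := ENNReal.ofReal_le_ofReal (by linarith)
        _ = ENNReal.ofReal y + ENNReal.ofReal (2 * θ) := ENNReal.ofReal_add hy0 (by positivity)
        _ ≤ (outerLIntegral (B.bootLaw n)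
              (fun w => ENNReal.ofReal (min (B.Tstar n x w ^ 2) (K ^ 2))) +
              ENNReal.ofReal (2 * θ)) + ENNReal.ofReal (2 * θ) :=
          add_le_add (hlow.trans (add_le_add le_rfl herr)) le_rfl
        _ ≤ (B.σbarsq n x + ENNReal.ofReal (2 * θ)) + ENNReal.ofReal (2 * θ) := by
          gcongr
          exact outerLIntegral_mono fun w => ENNReal.ofReal_le_ofReal (min_le_left _ _)
        _ = B.σbarsq n x + ENNReal.ofReal (4 * θ) := by
          rw [add_assoc, ← ENNReal.ofReal_add (by positivity) (by positivity)]
          congr 2; ring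
        _ ≤ _ := by gcongr; norm_num
  rw [← ENNReal.ofReal_add (by positivity) (by positivity)] at h5
  have h6 := (ENNReal.ofReal_le_ofReal_iff (by positivity)).1 (le_trans hle h5)
  linarith

/-- Consistency of the bootstrap standard deviation, from that of the bootstrap variance. -/
theorem convOuterProb_σbar (h : ConvOuterProb B.dataLaw
      (fun n x => absDiff (B.σbarsq n x) (ENNReal.ofReal B.σ₀sq))) :
    ConvOuterProb B.dataLaw
      (fun n x => absDiff (B.σbar n x) (ENNReal.ofReal (√B.σ₀sq))) := by
  intro ε hε
  refine tendsto_measure_zero_mono_ae (h ((ε / 2) ^ 2) (by positivity))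
    (Eventually.of_forall fun n => Eventually.of_forall fun x hx => ?_)
  have hv : 0 ≤ B.σ₀sq := integral_nonneg fun _ => sq_nonneg _
  have h1 : ENNReal.ofReal ε ≤ absDiff (B.σbar n x) (ENNReal.ofReal (√B.σ₀sq)) := hx
  rw [Real.sqrt_eq_rpow, ← ENNReal.ofReal_rpow_of_nonneg hv (by norm_num)] at h1
  by_contra hcon
  have h2 : absDiff (B.σbarsq n x) (ENNReal.ofReal B.σ₀sq) ^ (1 / 2 : ℝ) <
      ENNReal.ofReal (ε / 2) := by
    have := ENNReal.rpow_lt_rpow (not_le.1 hcon) (show (0 : ℝ) < 1 / 2 by norm_num)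
    rwa [ENNReal.ofReal_rpow_of_nonneg (by positivity) (by norm_num), ← Real.sqrt_eq_rpow,
      Real.sqrt_sq (by positivity)] at this
  have h3 := lt_of_le_of_lt (h1.trans (absDiff_rpow_half_le _ _)) (ENNReal.add_lt_add h2 h2)
  rw [← ENNReal.ofReal_add (by positivity) (by positivity), add_halves] at h3
  exact lt_irrefl _ h3

end BootstrapFramework

/-! ### Distribution functions without atoms -/

section Cdf

theorem continuous_cdf_of_nullSingletonClass (μ : Measure ℝ) [IsProbabilityMeasure μ] [NullSingletonClass μ] :
    Continuous (cdf μ) := by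
  refine continuous_iff_continuousAt.2 fun a => ?_
  have h : (cdf μ).measure {a} = 0 := by rw [measure_cdf]; exact measure_singleton a
  rw [StieltjesFunction.measure_singleton, ENNReal.ofReal_eq_zero] at h
  rw [(monotone_cdf μ).continuousAt_iff_leftLim_eq_rightLim, StieltjesFunction.rightLim_eq]
  exact le_antisymm ((monotone_cdf μ).leftLim_le le_rfl) (by linarith)

theorem measureReal_Icc_eq_cdf_sub (μ : Measure ℝ) [IsProbabilityMeasure μ] [NullSingletonClass μ] {a b : ℝ}
    (hab : a ≤ b) : μ.real (Set.Icc a b) = cdf μ b - cdf μ a := by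
  rw [cdf_eq_real, cdf_eq_real, ← measureReal_congr (Ioc_ae_eq_Icc (μ := μ)),
    ← measureReal_sdiff (Set.Iic_subset_Iic.2 hab) measurableSet_Iic, Set.Iic_sdiff_Iic]

/-- No order of the endpoints is assumed, since the shrunk interval in the coverage proof may be
empty. -/
theorem cdf_sub_le_measureReal_Icc (μ : Measure ℝ) [IsProbabilityMeasure μ] [NullSingletonClass μ] (a b : ℝ) :
    cdf μ b - cdf μ a ≤ μ.real (Set.Icc a b) := by
  rcases le_total a b with h | h
  · exact (measureReal_Icc_eq_cdf_sub μ h).ge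
  · exact (sub_nonpos.2 (monotone_cdf μ h)).trans measureReal_nonneg

/-- Without atoms the distribution function is continuous, so `p` is attained, and the infimum
defining the quantile belongs to its closed set. -/
theorem cdf_normalQuantile {p : ℝ} (h0 : 0 < p) (h1 : p < 1) :
    cdf (gaussianReal 0 1) (normalQuantile p) = p := by
  have : NullSingletonClass (gaussianReal 0 1) := nullSingletonClass_gaussianReal one_ne_zero
  have hcont := continuous_cdf_of_nullSingletonClass (gaussianReal 0 1)
  have hbot := tendsto_cdf_atBot (gaussianReal 0 1)
  have htop := tendsto_cdf_atTop (gaussianReal 0 1)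
  obtain ⟨z, hz⟩ : ∃ z, cdf (gaussianReal 0 1) z = p :=
    mem_range_of_exists_le_of_exists_ge hcont
      ((hbot.eventually (ge_mem_nhds h0)).exists) ((htop.eventually (le_mem_nhds h1)).exists)
  have hbdd : BddBelow {z : ℝ | p ≤ cdf (gaussianReal 0 1) z} := by
    obtain ⟨y, hy⟩ := (hbot.eventually (gt_mem_nhds h0)).exists
    refine ⟨y, fun w hw => ?_⟩
    by_contra hlt
    have h2 : p ≤ cdf (gaussianReal 0 1) w := hw
    linarith [monotone_cdf (gaussianReal 0 1) (not_le.1 hlt).le]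
  refine le_antisymm ?_ ?_
  · rw [← hz]
    exact monotone_cdf _ (csInf_le (hz ▸ hbdd) (le_refl (cdf (gaussianReal 0 1) z)))
  · exact (isClosed_le continuous_const hcont).csInf_mem ⟨z, hz.ge⟩ hbdd

theorem cdf_gaussianReal_sqrt_mul {v : ℝ} (hv : 0 < v) (z : ℝ) :
    cdf (gaussianReal 0 v.toNNReal) (√v * z) = cdf (gaussianReal 0 1) z := by
  have hs : 0 < √v := Real.sqrt_pos.2 hv
  have : gaussianReal 0 v.toNNReal = (gaussianReal 0 1).map (√v * ·) := by
    rw [gaussianReal_map_const_mul]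
    congr 1
    · simp
    · ext; simp [Real.sq_sqrt hv.le, hv.le]
  rw [cdf_eq_real, cdf_eq_real, this, map_measureReal_apply (by fun_prop) measurableSet_Iic]
  congr 1
  ext t
  exact mul_le_mul_iff_right₀ hs

end Cdf

/-- If the outer probabilities of events and of their complements are asymptotically at most `p`
and `1 - p`, then they converge to these values. -/
theorem tendsto_measure_and_compl {Ω : ℕ → Type*} [∀ n, MeasurableSpace (Ω n)]
    {μ : ∀ n, Measure (Ω n)} [∀ n, IsProbabilityMeasure (μ n)] {E : ∀ n, Set (Ω n)} {p : ℝ}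
    (h : ∀ η : ℝ, 0 < η → ∀ᶠ n in atTop, (μ n).real (E n) ≤ p + η ∧
      (μ n).real (E n)ᶜ ≤ 1 - p + η) :
    Tendsto (fun n => μ n (E n)) atTop (𝓝 (ENNReal.ofReal p)) ∧
      Tendsto (fun n => μ n (E n)ᶜ) atTop (𝓝 (ENNReal.ofReal (1 - p))) := by
  -- Subadditivity holds for non-measurable sets too, and turns each upper bound into a lower bound
  -- for the complementary event.
  have hsum : ∀ n, 1 ≤ (μ n).real (E n) + (μ n).real (E n)ᶜ := fun n => by
    have := measureReal_union_le (μ := μ n) (E n) (E n)ᶜ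
    rwa [Set.union_compl_self, probReal_univ] at this
  have key : ∀ (S : ∀ n, Set (Ω n)) (q : ℝ),
      (∀ η : ℝ, 0 < η → ∀ᶠ n in atTop, |(μ n).real (S n) - q| ≤ η) →
      Tendsto (fun n => μ n (S n)) atTop (𝓝 (ENNReal.ofReal q)) := by
    intro S q hS
    have h1 : Tendsto (fun n => (μ n).real (S n)) atTop (𝓝 q) := by
      refine Metric.tendsto_nhds.2 fun η hη => ?_
      filter_upwards [hS (η / 2) (by positivity)] with n hn
      rw [Real.dist_eq]; linarith
    exact ((ENNReal.continuous_ofReal.tendsto q).comp h1).congr fun n =>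
      ofReal_measureReal (measure_ne_top _ _)
  constructor
  · refine key _ _ fun η hη => (h η hη).mono fun n hn => abs_le.2 ?_
    constructor <;> linarith [hsum n, hn.1, hn.2]
  · refine key _ _ fun η hη => (h η hη).mono fun n hn => abs_le.2 ?_
    constructor <;> linarith [hsum n, hn.1, hn.2]

/-! ### Asymptotic normality and coverage -/

namespace BootstrapFramework

variable {𝒳 H : Type*} [MeasurableSpace 𝒳] (B : BootstrapFramework 𝒳 H)

/-- Asymptotic normality of the empirical process at the influence function. -/
theorem tendsto_measureReal_neg_empProc_mem_Icc (hA1 : B.CondA1) (hσ : 0 < B.σ₀sq) (a b : ℝ) :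
    Tendsto (fun n => (B.dataLaw n).real {x | -B.empProc n x B.φ₀ ∈ Set.Icc a b}) atTop
      (𝓝 ((gaussianReal 0 B.σ₀sq.toNNReal).real (Set.Icc a b))) := by
  obtain ⟨F, hFm, hφ₀, -, hmem, ν, hν, hconv⟩ := hA1
  have := hν.isProbabilityMeasure
  have : NullSingletonClass (gaussianReal 0 B.σ₀sq.toNNReal) := nullSingletonClass_gaussianReal (by simpa using hσ)
  set f₀ : F := ⟨B.φ₀, hφ₀⟩
  have hm : ∀ n, Measurable fun x => -B.empProc n x B.φ₀ :=
    fun n => (B.measurable_empProc (hFm _ hφ₀) n).neg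
  -- Coverage concerns the negated estimation error; the centered Gaussian law is symmetric.
  have hlaw : ν.map (fun z : EllInf F => -z f₀) = gaussianReal 0 B.σ₀sq.toNNReal := by
    have h1 := congrArg (fun m => Measure.map (fun t : ℝ => -t) m) (hν.map_apply (f := f₀) B.φ₀_mean)
    simp only [gaussianReal_map_neg, neg_zero] at h1
    rw [Measure.map_map measurable_neg (EllInf.measurable_apply f₀)] at h1
    exact h1
  let L : ℕ → ProbabilityMeasure ℝ := fun n =>
    ⟨(B.dataLaw n).map fun x => -B.empProc n x B.φ₀,
      Measure.isProbabilityMeasure_map (hm n).aemeasurable⟩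
  let Λ : ProbabilityMeasure ℝ := ⟨gaussianReal 0 B.σ₀sq.toNNReal, inferInstance⟩
  have hL : Tendsto L atTop (𝓝 Λ) := by
    rw [ProbabilityMeasure.tendsto_iff_forall_integral_tendsto]
    intro g
    let h : EllInf F →ᵇ ℝ := g.compContinuous
      ⟨fun z : EllInf F => -z f₀, (EllInf.lipschitzWith_apply f₀).continuous.neg⟩
    have hlim := hconv h
    have e1 : ∫ z, h z ∂ν = ∫ t, g t ∂(Λ : Measure ℝ) := by
      change _ = ∫ t, g t ∂(gaussianReal 0 B.σ₀sq.toNNReal)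
      rw [← hlaw]
      have hZ : Measurable fun z : EllInf F => -z f₀ := (EllInf.measurable_apply f₀).neg
      exact (integral_map hZ.aemeasurable g.continuous.aestronglyMeasurable).symm
    rw [e1] at hlim
    refine hlim.congr' ?_
    filter_upwards [hmem] with n hn
    have hgm : Measurable fun x => g (-B.empProc n x B.φ₀) := g.continuous.measurable.comp (hm n)
    rw [outerExp_eq_integral hgm]
    · exact (integral_map (hm n).aemeasurable g.continuous.aestronglyMeasurable).symm
    · exact Integrable.of_bound hgm.aestronglyMeasurable ‖g‖
        (Eventually.of_forall fun x => g.norm_coe_le_norm _)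
    · filter_upwards [hn] with x hx
      change g (-(toEllInf F fun f : F => B.empProc n x f) f₀) = _
      rw [toEllInf_apply hx f₀]
  have hfr : (Λ : Measure ℝ) (frontier (Set.Icc a b)) = 0 := by
    change gaussianReal 0 B.σ₀sq.toNNReal (frontier (Set.Icc a b)) = 0
    refine measure_mono_null (t := {a, b}) ?_ ((Set.toFinite {a, b}).measure_zero _)
    rcases le_or_gt a b with hab | hab
    · rw [frontier_Icc hab]
    · simp [Set.Icc_eq_empty (not_le.2 hab)]
  have h2 := ProbabilityMeasure.tendsto_measure_of_null_frontier_of_tendsto' hL hfr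
  have h3 := (ENNReal.tendsto_toReal (measure_ne_top _ _)).comp h2
  refine h3.congr fun n => ?_
  exact map_measureReal_apply (hm n) measurableSet_Icc

/-- The Wald interval in terms of the studentized estimation error. -/
theorem mem_waldInterval_iff {α β t : ℝ} (ht : 0 ≤ t) {n : ℕ} (hn : 0 < n) {x : Fin n → 𝒳}
    (hσ : B.σbar n x = ENNReal.ofReal t) :
    B.ψ₀ ∈ B.waldInterval α β n x ↔ -(√(n : ℝ) * (B.ψ n x - B.ψ₀)) ∈
      Set.Icc (normalQuantile β * t) (normalQuantile (1 - α) * t) := by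
  have hs : 0 < √(n : ℝ) := Real.sqrt_pos.2 (by exact_mod_cast hn)
  have e : ((ENNReal.ofReal t : ℝ≥0∞) : EReal) = (t : EReal) := by
    rw [EReal.coe_ennreal_ofReal, max_eq_left ht]
  simp only [waldInterval, Set.mem_ofPred_eq, hσ, e, ← EReal.coe_mul, ← EReal.coe_div,
    ← EReal.coe_add, EReal.coe_le_coe_iff, Set.mem_Icc]
  rw [← le_sub_iff_add_le', ← sub_le_iff_le_add', div_le_iff₀ hs, le_div_iff₀ hs]
  constructor <;> rintro ⟨h1, h2⟩ <;> constructor <;> linarith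

/-- Asymptotic level of the bootstrap Wald interval. -/
theorem tendsto_measure_mem_waldInterval (hA1 : B.CondA1) (hA2 : B.CondA2) (hA3 : B.CondA3)
    (hσbar : ConvOuterProb B.dataLaw
      (fun n x => absDiff (B.σbar n x) (ENNReal.ofReal (√B.σ₀sq))))
    (hσ : 0 < B.σ₀sq) {α β : ℝ} (hα : 0 < α) (hβ : 0 < β) (hαβ : α + β < 1) :
    Tendsto (fun n => B.dataLaw n {x | B.ψ₀ ∈ B.waldInterval α β n x}) atTop
        (𝓝 (ENNReal.ofReal (1 - α - β))) ∧
      Tendsto (fun n => B.dataLaw n {x | B.ψ₀ ∈ B.waldInterval α β n x}ᶜ) atTop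
        (𝓝 (ENNReal.ofReal (1 - (1 - α - β)))) := by
  have : NullSingletonClass (gaussianReal 0 B.σ₀sq.toNNReal) := nullSingletonClass_gaussianReal (by simpa using hσ)
  set Λ := gaussianReal 0 B.σ₀sq.toNNReal
  set s := √B.σ₀sq with hs
  set u := normalQuantile β
  set o := normalQuantile (1 - α)
  have hcu : cdf Λ (u * s) = β := by
    rw [mul_comm, cdf_gaussianReal_sqrt_mul hσ, cdf_normalQuantile hβ (by linarith)]
  have hco : cdf Λ (o * s) = 1 - α := by
    rw [mul_comm, cdf_gaussianReal_sqrt_mul hσ,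
      cdf_normalQuantile (by linarith) (by linarith)]
  have huo : u * s ≤ o * s := by
    by_contra hlt
    linarith [monotone_cdf Λ (not_le.1 hlt).le]
  have hcont := continuous_cdf_of_nullSingletonClass Λ
  refine tendsto_measure_and_compl fun η hη => ?_
  obtain ⟨τ, ⟨hτ1, hτ2⟩, hτ⟩ : ∃ τ : ℝ, (cdf Λ (o * s + τ) - cdf Λ (u * s - τ) < 1 - α - β + η / 2 ∧
      1 - α - β - η / 2 < cdf Λ (o * s - τ) - cdf Λ (u * s + τ)) ∧ 0 < τ := by
    have h1 : Tendsto (fun τ => cdf Λ (o * s + τ) - cdf Λ (u * s - τ)) (𝓝[>] 0)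
        (𝓝 (1 - α - β)) := by
      have : Continuous fun τ => cdf Λ (o * s + τ) - cdf Λ (u * s - τ) := by fun_prop
      simpa [hcu, hco] using (this.tendsto 0).mono_left nhdsWithin_le_nhds
    have h2 : Tendsto (fun τ => cdf Λ (o * s - τ) - cdf Λ (u * s + τ)) (𝓝[>] 0)
        (𝓝 (1 - α - β)) := by
      have : Continuous fun τ => cdf Λ (o * s - τ) - cdf Λ (u * s + τ) := by fun_prop
      simpa [hcu, hco] using (this.tendsto 0).mono_left nhdsWithin_le_nhds
    exact (((h1.eventually (gt_mem_nhds (by linarith))).and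
      (h2.eventually (lt_mem_nhds (by linarith)))).and self_mem_nhdsWithin).exists
  -- Errors in the scale move the endpoints by at most `|u| * ε` and `|o| * ε`, and linearization
  -- costs another `ε`; together these make up `τ`.
  set ε := τ / (|u| + |o| + 1)
  have hε : 0 < ε := by positivity
  have hετ : (|u| + |o| + 1) * ε = τ := by
    rw [mul_div_cancel₀]; positivity
  set bad : ∀ n, Set (Fin n → 𝒳) := fun n =>
    {x | ε ≤ |√(n : ℝ) * (B.ψ n x - B.ψ₀) - B.empProc n x B.φ₀|} ∪
      {x | ENNReal.ofReal ε ≤ absDiff (B.σbar n x) (ENNReal.ofReal s)}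
  have hbad : Tendsto (fun n => (B.dataLaw n).real (bad n)) atTop (𝓝 0) := by
    have := tendsto_measure_zero_union
      (B.tendsto_measure_estimator_sub_empProc hA1 hA2 hA3 hε) (hσbar ε hε)
    exact (ENNReal.tendsto_toReal ENNReal.zero_ne_top).comp this
  have hgood : ∀ n, 0 < n → ∀ x, x ∉ bad n → ∃ t : ℝ, (B.ψ₀ ∈ B.waldInterval α β n x ↔
      -(√(n : ℝ) * (B.ψ n x - B.ψ₀)) ∈ Set.Icc (u * t) (o * t)) ∧
      |u * t - u * s| ≤ |u| * ε ∧ |o * t - o * s| ≤ |o| * ε ∧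
      |√(n : ℝ) * (B.ψ n x - B.ψ₀) - B.empProc n x B.φ₀| < ε := by
    intro n hn x hx
    obtain ⟨hx1, hx2⟩ := not_or.1 hx
    simp only [Set.mem_ofPred_eq, not_le] at hx1 hx2
    have h1 : B.σbar n x - ENNReal.ofReal s < ENNReal.ofReal ε := lt_of_le_of_lt le_self_add hx2
    have h2 : ENNReal.ofReal s - B.σbar n x < ENNReal.ofReal ε := lt_of_le_of_lt le_add_self hx2
    -- The bootstrap deviation may be infinite for some data, but only inside `bad n`; elsewhere the
    -- interval has real endpoints.
    have hfin : B.σbar n x ≠ ∞ := by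
      intro htop
      rw [htop, ENNReal.top_sub ENNReal.ofReal_ne_top] at h1
      exact not_top_lt h1
    obtain ⟨t, ht, hσt⟩ : ∃ t : ℝ, 0 ≤ t ∧ B.σbar n x = ENNReal.ofReal t :=
      ⟨_, ENNReal.toReal_nonneg, (ENNReal.ofReal_toReal hfin).symm⟩
    rw [hσt, ← ENNReal.ofReal_sub _ (Real.sqrt_nonneg _), ENNReal.ofReal_lt_ofReal_iff hε] at h1
    rw [hσt, ← ENNReal.ofReal_sub _ ht, ENNReal.ofReal_lt_ofReal_iff hε] at h2
    have hts : |t - s| ≤ ε := abs_le.2 ⟨by linarith, by linarith⟩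
    refine ⟨t, B.mem_waldInterval_iff ht hn hσt, ?_, ?_, hx1⟩ <;>
    · rw [← mul_sub, abs_mul]
      gcongr
  have hup := (hbad.add (B.tendsto_measureReal_neg_empProc_mem_Icc hA1 hσ
    (u * s - τ) (o * s + τ))).eventually (gt_mem_nhds (a := 1 - α - β + η) (by
      rw [measureReal_Icc_eq_cdf_sub _ (by linarith)]; linarith))
  have hlow := (hbad.sub (B.tendsto_measureReal_neg_empProc_mem_Icc hA1 hσ
    (u * s + τ) (o * s - τ))).eventually (gt_mem_nhds (a := -(1 - α - β) + η) (by
      linarith [cdf_sub_le_measureReal_Icc Λ (u * s + τ) (o * s - τ)]))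
  have hτsum : |u| * ε + |o| * ε + ε = τ := by rw [← hετ]; ring
  have hu0 : 0 ≤ |u| * ε := by positivity
  have ho0 : 0 ≤ |o| * ε := by positivity
  filter_upwards [hup, hlow, eventually_gt_atTop 0] with n hn1 hn2 hn
  constructor
  · refine le_trans ?_ hn1.le
    refine (measureReal_mono (fun x hx => ?_)).trans (measureReal_union_le _ _)
    by_cases hxb : x ∈ bad n
    · exact Or.inl hxb
    refine Or.inr ?_
    obtain ⟨t, hiff, h1, h2, h3⟩ := hgood n hn x hxb
    obtain ⟨h4, h5⟩ := hiff.1 hx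
    rw [abs_le] at h1 h2
    rw [abs_lt] at h3
    exact ⟨by linarith, by linarith⟩
  -- The Wald event need not be measurable, but the shrunk event is, so its complement has
  -- probability exactly one minus its own.
  · have hmeas : MeasurableSet {x | -B.empProc n x B.φ₀ ∈ Set.Icc (u * s + τ) (o * s - τ)} := by
      obtain ⟨F, hFm, hφ₀, -⟩ := hA1
      exact (B.measurable_empProc (hFm _ hφ₀) n).neg measurableSet_Icc
    have hle : (B.dataLaw n).real {x | B.ψ₀ ∈ B.waldInterval α β n x}ᶜ ≤
        (B.dataLaw n).real (bad n) + (B.dataLaw n).real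
          {x | -B.empProc n x B.φ₀ ∈ Set.Icc (u * s + τ) (o * s - τ)}ᶜ := by
      refine (measureReal_mono (fun x hx => ?_)).trans (measureReal_union_le _ _)
      by_cases hxb : x ∈ bad n
      · exact Or.inl hxb
      refine Or.inr fun hmem => hx ?_
      obtain ⟨t, hiff, h1, h2, h3⟩ := hgood n hn x hxb
      obtain ⟨h4, h5⟩ := hmem
      rw [abs_le] at h1 h2
      rw [abs_lt] at h3
      exact hiff.2 ⟨by linarith, by linarith⟩
    rw [probReal_compl_eq_one_sub hmeas] at hle
    linarith

end BootstrapFramework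

theorem theorem5 {𝒳 H : Type*} [MeasurableSpace 𝒳] (B : BootstrapFramework 𝒳 H)
    (hA1 : B.CondA1) (hA2 : B.CondA2) (hA3 : B.CondA3)
    (hB1 : B.CondB1) (hB2 : B.CondB2) (hB3 : B.CondB3)
    (hT : B.AsympUnifSqIntegrable) :
    -- consistency of the bootstrap variance and of the bootstrap standard deviation
    ConvOuterProb B.dataLaw (fun n x => absDiff (B.σbarsq n x) (ENNReal.ofReal B.σ₀sq)) ∧
    ConvOuterProb B.dataLaw (fun n x => absDiff (B.σbar n x) (ENNReal.ofReal (√B.σ₀sq))) ∧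
    -- asymptotic level of the bootstrap Wald interval, for outer and for inner probability
    (0 < B.σ₀sq → ∀ α β : ℝ, 0 < α → 0 < β → α + β < 1 →
      Tendsto (fun n => B.dataLaw n {x | B.ψ₀ ∈ B.waldInterval α β n x}) atTop
        (𝓝 (ENNReal.ofReal (1 - α - β))) ∧
      Tendsto (fun n => B.dataLaw n {x | B.ψ₀ ∉ B.waldInterval α β n x}) atTop
        (𝓝 (ENNReal.ofReal (α + β)))) := by
  have hvar := B.convOuterProb_σbarsq hB1 hB2 hB3 hT
  have hsd := B.convOuterProb_σbar hvar
  refine ⟨hvar, hsd, fun hσ α β hα hβ hαβ => ?_⟩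
  have h := B.tendsto_measure_mem_waldInterval hA1 hA2 hA3 hsd hσ hα hβ hαβ
  rw [show 1 - (1 - α - β) = α + β by ring] at h
  exact h
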